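/- Let $M$ be a compact smooth manifold (without boundary) of dimension $m$ with a smooth Riemannian metric $g$, and let $N\subset M$ be a compact embedded smooth submanifold of dimension $n$ with $m\ge n+2$. Let $\tilde g$ be a smooth Riemannian metric on $M\setminus N$ and let $f\in C^\infty(M\setminus N)$ be real valued. Assume that near every point of $N$ there are smooth local coordinates $(x,y)=(x_1,\dots,x_{m-n},y_1,\dots,y_n)$ of $M$ in which $N$ is given by $x=0$, the metric $g$ is block-diagonal, and $\tilde g$ arises from it by multiplying the $x$-block by $f^2$: \[ g=\begin{pmatrix} g_1&0\\0&g_2\end{pmatrix},\qquad \tilde g=\begin{pmatrix} f^2g_1&0\\0&g_2\end{pmatrix}\ \text{ off } N, \] where $g_1$ and $g_2$ are matrix-valued functions of sizes $(m-n)\times(m-n)$ and $n\times n$. If $m=2$, assume that $f\in L^{2+\epsilon}_g(M)$ for some $\epsilon>0$. If $m\ge 3$, assume that $\inf_{M\setminus N} f>0$ and that $f\in L_g^{m(m-n)/2+\epsilon}(M)$ for some $\epsilon>0$. Let $W^{1,2}_{\tilde g}(M\setminus N)$ be the space of all $u\in L^2_{\tilde g}(M\setminus N)$ that have a weak gradient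 $\tilde\nabla u$ on $M\setminus N$ with $|\tilde\nabla u|_{\tilde g}\in L^2_{\tilde g}(M\setminus N)$, with the norm $\bigl(\int u^2\,d\tilde A+\int|\tilde\nabla u|_{\tilde g}^2\,d\tilde A\bigr)^{1/2}$, where $d\tilde A$ is the Riemannian measure of $\tilde g$. Then $W^{1,2}_{\tilde g}(M\setminus N)$ is compactly included in $L^2_{\tilde g}(M\setminus N)$, that is, every subset of $W^{1,2}_{\tilde g}(M\setminus N)$ that is bounded in its norm is relatively compact in $L^2_{\tilde g}(M\setminus N)$. -/

import Mathlib

open Set Filter Topology MeasureTheory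
open scoped Manifold ContDiff ENNReal NNReal

noncomputable section

/-- The model space `ℝᵐ`. -/
abbrev Rm (m : ℕ) : Type := EuclideanSpace ℝ (Fin m)

/-- Smooth Riemannian metrics on a smooth `m`-manifold `X` without boundary. -/
abbrev SmoothMetric (m : ℕ) (X : Type*) [TopologicalSpace X] [ChartedSpace (Rm m) X]
    [IsManifold (𝓡 m) ∞ X] : Type _ :=
  Bundle.ContMDiffRiemannianMetric (𝓡 m) ∞ (Rm m) (fun x : X => TangentSpace (𝓡 m) x)

/-- The complement of a compact subset of a Hausdorff space, as an open subset (and so, for a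
subset of a manifold, as an open submanifold). -/
def complOpens {M : Type*} [TopologicalSpace M] [T2Space M] {N : Set M} (hN : IsCompact N) :
    TopologicalSpace.Opens M :=
  ⟨Nᶜ, hN.isClosed.isOpen_compl⟩

section Riemannian

variable {m : ℕ} {X : Type*} [TopologicalSpace X] [ChartedSpace (Rm m) X]
  [IsManifold (𝓡 m) ∞ X]

/-- The `i`-th coordinate vector `∂ᵢ` of the chart `φ`, at the point with coordinates `y`. -/
def coordVec (φ : OpenPartialHomeomorph X (Rm m)) (y : Rm m) (i : Fin m) :
    TangentSpace (𝓡 m) (φ.symm y) :=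
  mfderiv (𝓡 m) (𝓡 m) φ.symm y (EuclideanSpace.single i (1 : ℝ) : Rm m)

/-- The matrix `(h(∂ᵢ, ∂ⱼ))` of the metric `h` in the chart `φ`, at the point with
coordinates `y`. -/
def gram (h : SmoothMetric m X) (φ : OpenPartialHomeomorph X (Rm m)) (y : Rm m) :
    Matrix (Fin m) (Fin m) ℝ :=
  Matrix.of fun i j => h.inner (φ.symm y) (coordVec φ y i) (coordVec φ y j)

variable [MeasurableSpace X]

/-- The Riemannian measure on the domain of the chart `φ`: the image of `√(det h) dy`
under `φ⁻¹`. -/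
def chartVolume (h : SmoothMetric m X) (φ : OpenPartialHomeomorph X (Rm m)) : Measure X :=
  (((volume : Measure (Rm m)).restrict φ.target).withDensity
    fun y => ENNReal.ofReal (Real.sqrt (gram h φ y).det)).map φ.symm

/-- The Riemannian measure of `(X, h)`. By the change of variables formula the measures
`chartVolume h φ` agree on the overlaps of the chart domains; on a second countable manifold their
least upper bound is therefore the unique measure that restricts to `chartVolume h φ` on the domain
of every smooth chart `φ`. -/
def riemVolume (h : SmoothMetric m X) : Measure X :=
  ⨆ φ ∈ IsManifold.maximalAtlas (𝓡 m) ∞ X, chartVolume h φ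

/-- `Z` is a weak gradient of `u` with respect to `h`: in every smooth chart, `u` and the functions
`h(Z, ∂ᵢ)` are locally integrable, and `h(Z, ∂ᵢ)` is the `i`-th distributional partial derivative
of `u`. -/
def IsWeakGradient (h : SmoothMetric m X) (u : X → ℝ) (Z : ∀ q : X, TangentSpace (𝓡 m) q) :
    Prop :=
  ∀ φ ∈ IsManifold.maximalAtlas (𝓡 m) ∞ X,
    LocallyIntegrableOn (fun y => u (φ.symm y)) φ.target volume ∧
    ∀ i : Fin m,
      LocallyIntegrableOn (fun y => h.inner (φ.symm y) (Z (φ.symm y)) (coordVec φ y i))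
        φ.target volume ∧
      ∀ ψ : Rm m → ℝ, ContDiff ℝ ∞ ψ → HasCompactSupport ψ → tsupport ψ ⊆ φ.target →
        ∫ y in φ.target, u (φ.symm y) * fderiv ℝ ψ y (EuclideanSpace.single i (1 : ℝ)) =
          -∫ y in φ.target, h.inner (φ.symm y) (Z (φ.symm y)) (coordVec φ y i) * ψ y

/-- The norm `(∫ u² + ∫ |∇u|²)^{1/2}` of `W^{1,2}_h(X)`, with value `∞` if `u` has no
square integrable weak gradient. (The weak gradient is unique almost everywhere, so that the infimum
has at most one value to choose from.) -/
def sobolevNorm (h : SmoothMetric m X) (u : X → ℝ) : ℝ≥0∞ :=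
  ⨅ (Z : ∀ q : X, TangentSpace (𝓡 m) q) (_ : IsWeakGradient h u Z),
    ((∫⁻ q, ENNReal.ofReal (u q ^ 2) ∂riemVolume h) +
      ∫⁻ q, ENNReal.ofReal (h.inner q (Z q) (Z q)) ∂riemVolume h) ^ (1 / 2 : ℝ)

/-- The Sobolev space `W^{1,2}_h(X)`, as a subset of `L²_h(X)`. -/
def sobolevSpace (h : SmoothMetric m X) : Set (Lp ℝ 2 (riemVolume h)) :=
  {u | sobolevNorm h u < ⊤}

/-- `W^{1,2}_h(X)` is compactly included in `L²_h(X)`: its norm-bounded subsets are relatively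
compact in `L²_h(X)`. -/
def SobolevCompactlyIncluded (h : SmoothMetric m X) : Prop :=
  ∀ S ⊆ sobolevSpace h, (∃ C : ℝ≥0, ∀ u ∈ S, sobolevNorm h u ≤ C) → IsCompact (closure S)

end Riemannian

section Coordinates

variable {m : ℕ}

/-- The index in `Fin m` of the coordinate `xᵢ`, for coordinates `(x₁, …, x_{m-n}, y₁, …, y_n)`. -/
def xIdx (m n : ℕ) (i : Fin (m - n)) : Fin m := Fin.castLE (Nat.sub_le m n) i

/-- The index in `Fin m` of the coordinate `yⱼ`, for coordinates `(x₁, …, x_{m-n}, y₁, …, y_n)`. -/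
def yIdx {m n : ℕ} (hnm : n ≤ m) (j : Fin n) : Fin m :=
  Fin.cast (Nat.sub_add_cancel hnm) (Fin.natAdd (m - n) j)

/-- The value `dκᵢ(v)` at the tangent vector `v` of the differential of the `i`-th component
of `κ : X → ℝᵐ`. -/
def dcoord {X : Type*} [TopologicalSpace X] [ChartedSpace (Rm m) X]
    (κ : X → Rm m) (i : Fin m) (q : X) (v : TangentSpace (𝓡 m) q) : ℝ :=
  (show Rm m from mfderiv (𝓡 m) (𝓡 m) κ q v) i

/-- The bilinear form `∑ Aᵢⱼ dxᵢ dxⱼ + ∑ Bᵢⱼ dyᵢ dyⱼ`, that is, the form with the block matrix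
`diag(A, B)` in the coordinates `κ = (x, y)`. -/
def blockForm {X : Type*} [TopologicalSpace X] [ChartedSpace (Rm m) X] {n : ℕ} (hnm : n ≤ m)
    (κ : X → Rm m) (A : Matrix (Fin (m - n)) (Fin (m - n)) ℝ) (B : Matrix (Fin n) (Fin n) ℝ)
    (q : X) (v w : TangentSpace (𝓡 m) q) : ℝ :=
  (∑ i, ∑ j, A i j * dcoord κ (xIdx m n i) q v * dcoord κ (xIdx m n j) q w) +
    ∑ i, ∑ j, B i j * dcoord κ (yIdx hnm i) q v * dcoord κ (yIdx hnm j) q w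

/-- `φ` is a smooth chart of `M` with coordinates `(x, y)` in which `N` is given by `x = 0`. -/
def IsSliceChart {M : Type*} [TopologicalSpace M] [ChartedSpace (Rm m) M] (n : ℕ)
    (N : Set M) (φ : OpenPartialHomeomorph M (Rm m)) : Prop :=
  φ ∈ IsManifold.maximalAtlas (𝓡 m) ∞ M ∧
    ∀ q ∈ φ.source, q ∈ N ↔ ∀ i : Fin (m - n), φ q (xIdx m n i) = 0

/-- `N` is an `n`-dimensional (embedded, smooth) submanifold of the `m`-manifold `M`. -/
def IsSubmanifold {M : Type*} [TopologicalSpace M] [ChartedSpace (Rm m) M] (n : ℕ)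
    (N : Set M) : Prop :=
  n ≤ m ∧ ∀ p ∈ N, ∃ φ : OpenPartialHomeomorph M (Rm m), p ∈ φ.source ∧ IsSliceChart n N φ

end Coordinates

end

/-!
A weakly differentiable function satisfies the fundamental theorem of calculus along almost every
segment. In a slice chart the singular set `N = {x = 0}` has codimension at least two, so almost
every segment misses it, and off `N` the Euclidean argument for the Poincaré inequality applies in
spite of the singularity of `g̃`.

The metric enters through the volume density `w = √(det g̃) = |f| ^ (m - n) √(det g)` only. The
exponent of `f` is chosen so that `w` is locally in `L^q` for some `q > m / 2`, and this suffices
for `∬_{P × P} |u x - u z|² w(x) dx dz ≤ C d ^ (2 + m - m / q) ∫_P |∇u|²` on convex sets `P` of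
diameter `d`. As `2 - m / q > 0`, on a cube `P` the right-hand side is small relative to the volume,
so `u` is `L²(w)`-close to a constant there. The lower bound on `f` (or `m - n = 2`) makes `w`
dominate the trace of `g̃`, and hence the Euclidean Dirichlet integral is at most a constant times
the Riemannian one. Bounded subsets of `W^{1,2}` are therefore uniformly close in `L²` to bounded
sets of step functions on finitely many small cubes, hence totally bounded.
-/

noncomputable section

section Segment

variable {E : Type*} [NormedAddCommGroup E] [NormedSpace ℝ E]

theorem add_smul_mem_segment (x e : E) {t : ℝ} (ht : t ∈ Icc (0 : ℝ) 1) :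
    x + t • e ∈ segment ℝ x (x + e) := by
  rw [segment_eq_image']
  exact ⟨t, ht, by simp⟩

theorem isOpen_setOf_segment_subset {U : Set E} (hU : IsOpen U) :
    IsOpen {p : E × E | segment ℝ p.1 p.2 ⊆ U} := by
  simp_rw [segment_eq_image', image_subset_iff]
  refine isOpen_iff_mem_nhds.2 fun p hp => ?_
  refine isCompact_Icc.eventually_forall_of_forall_eventually (x₀ := p)
    (P := fun q t => q.1 + t • (q.2 - q.1) ∈ U) fun t ht => ?_
  have hcont : Continuous fun z : (E × E) × ℝ => z.1.1 + z.2 • (z.1.2 - z.1.1) := by fun_prop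
  exact hcont.continuousAt.preimage_mem_nhds (hU.mem_nhds (hp ht))

/-- The union of the segments from `x` to `x + e`, for `x ∈ K`. Pairing a test function supported in
`K` with differences along `e` only sees this set. -/
def sweep (K : Set E) (e : E) : Set E := ⋃ x ∈ K, segment ℝ x (x + e)

theorem segment_subset_sweep {K : Set E} {x : E} (hx : x ∈ K) (e : E) :
    segment ℝ x (x + e) ⊆ sweep K e :=
  subset_biUnion_of_mem (u := fun x => segment ℝ x (x + e)) hx

theorem isCompact_sweep {K : Set E} (hK : IsCompact K) (e : E) : IsCompact (sweep K e) := by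
  have h : sweep K e = (fun p : E × ℝ => p.1 + p.2 • e) '' (K ×ˢ Icc (0 : ℝ) 1) := by
    ext y
    simp [sweep, segment_eq_image', and_assoc]
  rw [h]
  exact (hK.prod isCompact_Icc).image (by fun_prop)

end Segment

section SegmentAverage

universe u

/-- The average of `ψ` over the segment from `y - e` to `y`: the primitive of the difference
`ψ y - ψ (y - e)` in the direction `e`, which is used as a test function. -/
def segmentAverage {E F : Type*} [NormedAddCommGroup E] [NormedSpace ℝ E] [NormedAddCommGroup F]
    [NormedSpace ℝ F] (ψ : E → F) (e y : E) : F :=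
  ∫ t in (0 : ℝ)..1, ψ (y - t • e)

theorem hasFDerivAt_segmentAverage {E F : Type*} [NormedAddCommGroup E] [NormedSpace ℝ E]
    [NormedAddCommGroup F] [NormedSpace ℝ F] {ψ : E → F} (hψ : ContDiff ℝ 1 ψ)
    (hc : HasCompactSupport ψ) (e y : E) :
    HasFDerivAt (segmentAverage ψ e) (segmentAverage (fderiv ℝ ψ) e y) y := by
  have hd : Continuous (fderiv ℝ ψ) := hψ.continuous_fderiv one_ne_zero
  obtain ⟨C, hC⟩ := (hc.fderiv ℝ).exists_bound_of_continuous hd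
  refine intervalIntegral.hasFDerivAt_integral_of_dominated_of_fderiv_le
    (F := fun y t => ψ (y - t • e)) (F' := fun y t => fderiv ℝ ψ (y - t • e))
    (bound := fun _ => C) (s := univ) univ_mem ?_ ?_ ?_ ?_ intervalIntegrable_const ?_
  · exact Eventually.of_forall fun z => (hψ.continuous.comp (by fun_prop)).aestronglyMeasurable
  · exact (hψ.continuous.comp (by fun_prop)).intervalIntegrable _ _
  · exact (hd.comp (by fun_prop)).aestronglyMeasurable
  · exact Eventually.of_forall fun t _ z _ => hC _
  · refine Eventually.of_forall fun t _ z _ => ?_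
    exact (hasFDerivAt_comp_sub _).2 (hψ.differentiable one_ne_zero _).hasFDerivAt

/- The derivative of an average is the average of the derivative, which takes values in `E →L[ℝ] F`;
the common universe lets the induction run over the codomain. -/
theorem contDiff_segmentAverage {E F : Type u} [NormedAddCommGroup E] [NormedSpace ℝ E]
    [NormedAddCommGroup F] [NormedSpace ℝ F] {ψ : E → F} (hψ : ContDiff ℝ ∞ ψ)
    (hc : HasCompactSupport ψ) (e : E) : ContDiff ℝ ∞ (segmentAverage ψ e) := by
  refine contDiff_infty.2 fun n => ?_
  induction n generalizing F with
  | zero =>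
    exact contDiff_zero.2 (continuous_iff_continuousAt.2 fun y =>
      (hasFDerivAt_segmentAverage (hψ.of_le (by simp)) hc e y).continuousAt)
  | succ n ih =>
    have hderiv := hasFDerivAt_segmentAverage (hψ.of_le (by simp)) hc e
    refine (contDiff_succ_iff_fderiv (n := n)).2 ⟨fun y => (hderiv y).differentiableAt, by simp, ?_⟩
    rw [funext fun y => (hderiv y).fderiv]
    exact ih (hψ.fderiv_right (by simp)) (hc.fderiv ℝ)

variable {E : Type*} [NormedAddCommGroup E] [NormedSpace ℝ E]

theorem fderiv_segmentAverage_apply {ψ : E → ℝ} (hψ : ContDiff ℝ 1 ψ) (hc : HasCompactSupport ψ)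
    (e y : E) : fderiv ℝ (segmentAverage ψ e) y e = ψ y - ψ (y - e) := by
  have hd : Continuous (fderiv ℝ ψ) := hψ.continuous_fderiv one_ne_zero
  have happly : segmentAverage (fderiv ℝ ψ) e y e = ∫ t in (0 : ℝ)..1, fderiv ℝ ψ (y - t • e) e :=
    ContinuousLinearMap.intervalIntegral_apply ((hd.comp (by fun_prop)).intervalIntegrable _ _) e
  have hderiv : ∀ t ∈ uIcc (0 : ℝ) 1,
      HasDerivAt (fun t : ℝ => -ψ (y - t • e)) (fderiv ℝ ψ (y - t • e) e) t := by
    intro t _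
    have hline : HasDerivAt (fun t : ℝ => y - t • e) (-e) t := by
      simpa using ((hasDerivAt_id t).smul_const e).const_sub y
    have hψt := (hψ.differentiable one_ne_zero (y - t • e)).hasFDerivAt
    have hcomp := (hψt.comp_hasDerivAt t hline).fun_neg
    rwa [map_neg, neg_neg] at hcomp
  rw [(hasFDerivAt_segmentAverage hψ hc e y).fderiv, happly,
    intervalIntegral.integral_eq_sub_of_hasDerivAt hderiv
      (Continuous.intervalIntegrable (by fun_prop) _ _), one_smul, zero_smul, sub_zero]
  ring

theorem segmentAverage_eq_zero {ψ : E → ℝ} {e y : E} (hy : y ∉ sweep (tsupport ψ) e) :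
    segmentAverage ψ e y = 0 := by
  refine intervalIntegral.integral_zero_ae (Eventually.of_forall fun t ht => ?_)
  rw [uIoc_of_le zero_le_one] at ht
  by_contra h
  have hmem := segment_subset_sweep (subset_tsupport ψ h) e
    (add_smul_mem_segment (y - t • e) e (Ioc_subset_Icc_self ht))
  exact hy (by rwa [sub_add_cancel] at hmem)

theorem tsupport_segmentAverage_subset {ψ : E → ℝ} (hc : HasCompactSupport ψ) (e : E) :
    tsupport (segmentAverage ψ e) ⊆ sweep (tsupport ψ) e :=
  closure_minimal (fun _ hy => by_contra fun h => hy (segmentAverage_eq_zero h))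
    (isCompact_sweep hc e).isClosed

end SegmentAverage

section SegmentDefect

variable {E : Type*} [NormedAddCommGroup E] [NormedSpace ℝ E]

/-- The error in the fundamental theorem of calculus along the segment from `x` to `x + e`, for a
function `v` with directional derivative `D` along `e`. -/
def segmentDefect (e : E) (v D : E → ℝ) (x : E) : ℝ :=
  v (x + e) - v x - ∫ t in (0 : ℝ)..1, D (x + t • e)

theorem segmentDefect_indicator {S : Set E} {e x : E} (h : segment ℝ x (x + e) ⊆ S) (v D : E → ℝ) :
    segmentDefect e (S.indicator v) (S.indicator D) x = segmentDefect e v D x := by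
  have hI : ∫ t in (0 : ℝ)..1, S.indicator D (x + t • e) = ∫ t in (0 : ℝ)..1, D (x + t • e) := by
    refine intervalIntegral.integral_congr fun t ht => ?_
    rw [uIcc_of_le zero_le_one] at ht
    exact indicator_of_mem (h (add_smul_mem_segment x e ht)) _
  rw [segmentDefect, segmentDefect, hI, indicator_of_mem (h (right_mem_segment ℝ _ _)),
    indicator_of_mem (h (left_mem_segment ℝ _ _))]

variable [MeasurableSpace E] [BorelSpace E] [FiniteDimensional ℝ E] {μ : Measure E}
  [μ.IsAddHaarMeasure]

theorem integrable_comp_add_smul {D : E → ℝ} (hD : Integrable D μ) (e : E) :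
    Integrable (fun p : ℝ × E => D (p.2 + p.1 • e)) ((volume.restrict (Ioc (0 : ℝ) 1)).prod μ) := by
  have hT : MeasurePreserving (fun p : ℝ × E => (p.1, p.2 + p.1 • e))
      ((volume.restrict (Ioc (0 : ℝ) 1)).prod μ) ((volume.restrict (Ioc (0 : ℝ) 1)).prod μ) :=
    (MeasurePreserving.id _).skew_product (g := fun t x => x + t • e) (by fun_prop)
      (Eventually.of_forall fun t => (measurePreserving_add_right μ (t • e)).map_eq)
  exact hT.integrable_comp_of_integrable (hD.comp_snd _)

theorem integrable_integral_add_smul {D : E → ℝ} (hD : Integrable D μ) (e : E) :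
    Integrable (fun x => ∫ t in (0 : ℝ)..1, D (x + t • e)) μ := by
  simp_rw [intervalIntegral.integral_of_le zero_le_one]
  exact (integrable_comp_add_smul hD e).integral_prod_right

theorem integrable_segmentDefect {v D : E → ℝ} (hv : Integrable v μ) (hD : Integrable D μ)
    (e : E) : Integrable (segmentDefect e v D) μ :=
  ((hv.comp_add_right e).sub hv).sub (integrable_integral_add_smul hD e)

theorem integral_mul_integral_add_smul {D ψ : E → ℝ} (hD : Integrable D μ) (hψ : Continuous ψ)
    (hc : HasCompactSupport ψ) (e : E) :
    ∫ x, ψ x * (∫ t in (0 : ℝ)..1, D (x + t • e)) ∂μ = ∫ y, D y * segmentAverage ψ e y ∂μ := by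
  obtain ⟨C, hC⟩ := hc.exists_bound_of_continuous hψ
  have hI : Integrable (fun p : ℝ × E => ψ p.2 * D (p.2 + p.1 • e))
      ((volume.restrict (Ioc (0 : ℝ) 1)).prod μ) :=
    (integrable_comp_add_smul hD e).bdd_mul (c := C) (by fun_prop)
      (Eventually.of_forall fun p => hC _)
  have hI' : Integrable (fun p : ℝ × E => ψ (p.2 - p.1 • e) * D p.2)
      ((volume.restrict (Ioc (0 : ℝ) 1)).prod μ) :=
    (hD.comp_snd _).bdd_mul (c := C)
      ((hψ.comp (by fun_prop)).aestronglyMeasurable) (Eventually.of_forall fun p => hC _)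
  calc ∫ x, ψ x * (∫ t in (0 : ℝ)..1, D (x + t • e)) ∂μ
      = ∫ x, (∫ t in Ioc (0 : ℝ) 1, ψ x * D (x + t • e)) ∂μ := by
        simp_rw [intervalIntegral.integral_of_le zero_le_one, integral_const_mul]
    _ = ∫ t in Ioc (0 : ℝ) 1, ∫ x, ψ x * D (x + t • e) ∂μ := (integral_integral_swap hI).symm
    _ = ∫ t in Ioc (0 : ℝ) 1, ∫ y, ψ (y - t • e) * D y ∂μ := by
        congr with t
        simpa using integral_add_right_eq_self (μ := μ) (fun y => ψ (y - t • e) * D y) (t • e)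
    _ = ∫ y, (∫ t in Ioc (0 : ℝ) 1, ψ (y - t • e) * D y) ∂μ := integral_integral_swap hI'
    _ = ∫ y, D y * segmentAverage ψ e y ∂μ := by
        unfold segmentAverage
        simp_rw [intervalIntegral.integral_of_le zero_le_one, integral_mul_const, mul_comm]

theorem integral_mul_segmentDefect {v D ψ : E → ℝ} (hv : Integrable v μ) (hD : Integrable D μ)
    (hψ : Continuous ψ) (hc : HasCompactSupport ψ) (e : E) :
    ∫ x, ψ x * segmentDefect e v D x ∂μ =
      -(∫ y, v y * (ψ y - ψ (y - e)) ∂μ) - ∫ y, D y * segmentAverage ψ e y ∂μ := by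
  obtain ⟨C, hC⟩ := hc.exists_bound_of_continuous hψ
  have hmul : ∀ {k : E → ℝ}, Integrable k μ → Integrable (fun x => ψ x * k x) μ := fun hk =>
    hk.bdd_mul (c := C) hψ.aestronglyMeasurable (Eventually.of_forall hC)
  have hshift : Integrable (fun y => ψ (y - e) * v y) μ :=
    hv.bdd_mul (c := C) (hψ.comp (by fun_prop)).aestronglyMeasurable
      (Eventually.of_forall fun y => hC _)
  have htranslate : ∫ x, ψ x * v (x + e) ∂μ = ∫ y, ψ (y - e) * v y ∂μ := by
    simpa using integral_add_right_eq_self (μ := μ) (fun y => ψ (y - e) * v y) e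
  have hdiff : ∫ y, v y * (ψ y - ψ (y - e)) ∂μ = ∫ y, ψ y * v y ∂μ - ∫ y, ψ (y - e) * v y ∂μ := by
    rw [← integral_sub (hmul hv) hshift]
    exact integral_congr_ae (Eventually.of_forall fun y => by ring)
  simp_rw [segmentDefect, mul_sub (ψ _) (v _ - v _), mul_sub (ψ _) (v _)]
  rw [integral_sub (f := fun x => ψ x * v (x + e) - ψ x * v x)
      ((hmul (hv.comp_add_right e)).sub (hmul hv)) (hmul (integrable_integral_add_smul hD e)),
    integral_sub (hmul (hv.comp_add_right e)) (hmul hv),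
    integral_mul_integral_add_smul hD hψ hc e, hdiff, htranslate]
  ring

end SegmentDefect

section WeakPartials

variable {m : ℕ} {U : Set (Rm m)} {v : Rm m → ℝ} {G : Fin m → Rm m → ℝ}

theorem integrableOn_mul_of_tsupport_subset {k : Rm m → ℝ}
    (hv : LocallyIntegrableOn v U volume) (hk : Continuous k) (hc : HasCompactSupport k)
    (hU : tsupport k ⊆ U) : IntegrableOn (fun y => v y * k y) U volume := by
  refine Integrable.integrableOn ?_
  refine (integrableOn_iff_integrable_of_support_subset fun y hy => ?_).1
    ((hv.integrableOn_compact_subset hU hc).mul_continuousOn hk.continuousOn hc)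
  exact subset_tsupport k (right_ne_zero_of_mul hy)

theorem setIntegral_mul_eq_integral_indicator_mul {S : Set (Rm m)}
    (hSU : S ⊆ U) {k : Rm m → ℝ} (hk : ∀ y ∉ S, k y = 0) :
    ∫ y in U, v y * k y = ∫ y, S.indicator v y * k y := by
  rw [setIntegral_eq_integral_of_forall_compl_eq_zero fun y hy => by
    rw [hk y fun hyS => hy (hSU hyS), mul_zero]]
  congr with y
  by_cases hy : y ∈ S
  · rw [indicator_of_mem hy]
  · rw [hk y hy, mul_zero, mul_zero]

/-- The functions `G i` are the distributional partial derivatives of `v` on the open set `U`. -/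
def HasWeakPartials (U : Set (Rm m)) (v : Rm m → ℝ) (G : Fin m → Rm m → ℝ) : Prop :=
  LocallyIntegrableOn v U volume ∧ ∀ i : Fin m, LocallyIntegrableOn (G i) U volume ∧
    ∀ ψ : Rm m → ℝ, ContDiff ℝ ∞ ψ → HasCompactSupport ψ → tsupport ψ ⊆ U →
      ∫ y in U, v y * fderiv ℝ ψ y (EuclideanSpace.single i (1 : ℝ)) = -∫ y in U, G i y * ψ y

namespace HasWeakPartials

theorem locallyIntegrableOn_sum_mul (h : HasWeakPartials U v G) (hU : IsOpen U) (e : Rm m) :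
    LocallyIntegrableOn (fun y => ∑ i, e i * G i y) U volume := by
  refine (locallyIntegrableOn_iff hU.isLocallyClosed).2 fun K hKU hK => ?_
  exact integrable_finsetSum _ fun i _ =>
    ((h.2 i).1.integrableOn_compact_subset hKU hK).const_mul _

theorem integral_mul_fderiv (h : HasWeakPartials U v G) (e : Rm m) {ψ : Rm m → ℝ}
    (hψ : ContDiff ℝ ∞ ψ) (hc : HasCompactSupport ψ) (hU : tsupport ψ ⊆ U) :
    ∫ y in U, v y * fderiv ℝ ψ y e = -∫ y in U, (∑ i, e i * G i y) * ψ y := by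
  have he : e = ∑ i, e i • (EuclideanSpace.single i (1 : ℝ) : Rm m) := by
    ext j
    simp [Finset.sum_apply, Pi.single_apply]
  have hleft : ∀ y, v y * fderiv ℝ ψ y e
      = ∑ i, e i * (v y * fderiv ℝ ψ y (EuclideanSpace.single i (1 : ℝ))) := by
    intro y
    conv_lhs => rw [he]
    simp only [map_sum, map_smul, smul_eq_mul, Finset.mul_sum, mul_left_comm]
  have hright : ∀ y, (∑ i, e i * G i y) * ψ y = ∑ i, e i * (G i y * ψ y) := fun y => by
    simp only [Finset.sum_mul, mul_assoc]
  have hd : Continuous (fderiv ℝ ψ) := hψ.continuous_fderiv (by simp)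
  have hintv : ∀ i : Fin m, IntegrableOn
      (fun y => v y * fderiv ℝ ψ y (EuclideanSpace.single i (1 : ℝ))) U volume := fun i =>
    integrableOn_mul_of_tsupport_subset h.1 (by fun_prop) (hc.fderiv_apply ℝ _)
      ((tsupport_fderiv_apply_subset ℝ _).trans hU)
  have hintG : ∀ i : Fin m, IntegrableOn (fun y => G i y * ψ y) U volume := fun i =>
    integrableOn_mul_of_tsupport_subset (h.2 i).1 hψ.continuous hc hU
  simp_rw [hleft, hright]
  rw [integral_finsetSum _ fun i _ => (hintv i).const_mul _,
    integral_finsetSum _ fun i _ => (hintG i).const_mul _, ← Finset.sum_neg_distrib]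
  refine Finset.sum_congr rfl fun i _ => ?_
  rw [integral_const_mul, integral_const_mul, (h.2 i).2 ψ hψ hc hU, mul_neg]

theorem integral_mul_segmentDefect_eq_zero (h : HasWeakPartials U v G) (hU : IsOpen U) {e : Rm m}
    {ψ : Rm m → ℝ} (hψ : ContDiff ℝ ∞ ψ) (hc : HasCompactSupport ψ)
    (hSU : sweep (tsupport ψ) e ⊆ U) :
    ∫ x, ψ x * segmentDefect e v (fun y => ∑ i, e i * G i y) x = 0 := by
  set D : Rm m → ℝ := fun y => ∑ i, e i * G i y
  set S := sweep (tsupport ψ) e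
  have hS : IsCompact S := isCompact_sweep hc e
  have hext : ∀ {k : Rm m → ℝ}, LocallyIntegrableOn k U volume → Integrable (S.indicator k) :=
    fun hk => (hk.integrableOn_compact_subset hSU hS).integrable_indicator hS.measurableSet
  have hdiff : ∀ y ∉ S, ψ y - ψ (y - e) = 0 := by
    intro y hy
    rw [image_eq_zero_of_notMem_tsupport fun h' =>
        hy (segment_subset_sweep h' e (left_mem_segment ℝ _ _)),
      image_eq_zero_of_notMem_tsupport fun h' =>
        hy (segment_subset_sweep h' e (by simpa using right_mem_segment ℝ (y - e) y)), sub_zero]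
  have hweak : ∫ y, S.indicator v y * (ψ y - ψ (y - e)) =
      -∫ y, S.indicator D y * segmentAverage ψ e y := by
    have havg := tsupport_segmentAverage_subset hc e
    rw [← setIntegral_mul_eq_integral_indicator_mul hSU hdiff,
      ← setIntegral_mul_eq_integral_indicator_mul hSU fun y hy => segmentAverage_eq_zero hy,
      ← h.integral_mul_fderiv e (contDiff_segmentAverage hψ hc e)
        (hS.of_isClosed_subset (isClosed_tsupport _) havg) (havg.trans hSU)]
    simp_rw [fderiv_segmentAverage_apply (hψ.of_le (by simp)) hc e]
  calc ∫ x, ψ x * segmentDefect e v D x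
      = ∫ x, ψ x * segmentDefect e (S.indicator v) (S.indicator D) x := by
        congr with x
        by_cases hx : x ∈ tsupport ψ
        · rw [segmentDefect_indicator (segment_subset_sweep hx e)]
        · rw [image_eq_zero_of_notMem_tsupport hx, zero_mul, zero_mul]
    _ = 0 := by
        rw [integral_mul_segmentDefect (hext h.1) (hext (h.locallyIntegrableOn_sum_mul hU e))
          hψ.continuous hc e, hweak]
        ring

theorem ae_sub_eq_integral (h : HasWeakPartials U v G) (hU : IsOpen U) (e : Rm m) :
    ∀ᵐ x, segment ℝ x (x + e) ⊆ U →
      v (x + e) - v x = ∫ t in (0 : ℝ)..1, ∑ i, e i * G i (x + t • e) := by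
  set V : Set (Rm m) := {x | segment ℝ x (x + e) ⊆ U}
  have hV : IsOpen V :=
    (isOpen_setOf_segment_subset hU).preimage (f := fun x => (x, x + e)) (by fun_prop)
  have hsweep : ∀ K ⊆ V, sweep K e ⊆ U := fun K hK => iUnion₂_subset fun x hx => hK hx
  have hloc : LocallyIntegrableOn (segmentDefect e v fun y => ∑ i, e i * G i y) V volume := by
    refine (locallyIntegrableOn_iff hV.isLocallyClosed).2 fun K hKV hK => ?_
    have hS := isCompact_sweep hK e
    have hext : ∀ {k : Rm m → ℝ}, LocallyIntegrableOn k U volume →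
        Integrable ((sweep K e).indicator k) := fun hk =>
      (hk.integrableOn_compact_subset (hsweep K hKV) hS).integrable_indicator hS.measurableSet
    exact (integrable_segmentDefect (hext h.1)
      (hext (h.locallyIntegrableOn_sum_mul hU e)) e).integrableOn.congr_fun
      (fun x hx => segmentDefect_indicator (segment_subset_sweep hx e) _ _) hK.measurableSet
  filter_upwards [hV.ae_eq_zero_of_integral_contDiff_smul_eq_zero hloc fun ψ hψ hc hψV =>
    h.integral_mul_segmentDefect_eq_zero hU hψ hc (hsweep _ hψV)] with x hx hxV
  exact sub_eq_zero.1 (hx hxV)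

end HasWeakPartials

end WeakPartials

section WeightedPoincare

theorem lintegral_homothety {E : Type*} [NormedAddCommGroup E] [NormedSpace ℝ E]
    [FiniteDimensional ℝ E] [MeasurableSpace E] [BorelSpace E] (μ : Measure E) [μ.IsAddHaarMeasure]
    {g : E → ℝ≥0∞} (hg : Measurable g) (x : E) {t : ℝ} (ht : 0 < t) :
    ∫⁻ z, g (x + t • (z - x)) ∂μ =
      ENNReal.ofReal ((t ^ Module.finrank ℝ E)⁻¹) * ∫⁻ y, g y ∂μ := by
  calc ∫⁻ z, g (x + t • (z - x)) ∂μ = ∫⁻ z, g (x + t • z) ∂μ :=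
        lintegral_sub_right_eq_self (fun z => g (x + t • z)) x
    _ = ∫⁻ y, g (x + y) ∂(Measure.map (t • ·) μ) := by
        rw [lintegral_map (by fun_prop) (by fun_prop)]
    _ = ENNReal.ofReal ((t ^ Module.finrank ℝ E)⁻¹) * ∫⁻ y, g (x + y) ∂μ := by
        rw [Measure.map_addHaar_smul μ ht.ne', lintegral_smul_measure, smul_eq_mul,
          abs_of_pos (by positivity)]
    _ = ENNReal.ofReal ((t ^ Module.finrank ℝ E)⁻¹) * ∫⁻ y, g y ∂μ := by
        rw [lintegral_add_left_eq_self g x]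

theorem lintegral_Ioc_rpow_ne_top {r : ℝ} (hr : -1 < r) :
    ∫⁻ t in Ioc (0 : ℝ) 1, ENNReal.ofReal (t ^ r) ≠ ⊤ :=
  have h : IntegrableOn (fun t : ℝ => t ^ r) (Ioc 0 1) :=
    (intervalIntegrable_iff_integrableOn_Ioc_of_le zero_le_one).1
      (intervalIntegral.intervalIntegrable_rpow' hr)
  h.lintegral_lt_top.ne

theorem sq_lintegral_le_lintegral_inv_mul {α : Type*} [MeasurableSpace α] {μ : Measure α}
    {ρ a : α → ℝ≥0∞} (hρ : AEMeasurable ρ μ) (ha : AEMeasurable a μ) (hρ0 : ∀ᵐ x ∂μ, ρ x ≠ 0)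
    (hρtop : ∀ᵐ x ∂μ, ρ x ≠ ⊤) :
    (∫⁻ x, a x ∂μ) ^ 2 ≤ (∫⁻ x, (ρ x)⁻¹ ∂μ) * ∫⁻ x, ρ x * a x ^ 2 ∂μ := by
  have hsq : ∀ b : ℝ≥0∞, (b ^ (1 / 2 : ℝ)) ^ 2 = b := fun b => by
    rw [← ENNReal.rpow_two, ← ENNReal.rpow_mul]
    norm_num
  have hmul : ∫⁻ x, ((ρ x)⁻¹ ^ (1 / 2 : ℝ)) * (ρ x ^ (1 / 2 : ℝ) * a x) ∂μ = ∫⁻ x, a x ∂μ := by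
    refine lintegral_congr_ae ?_
    filter_upwards [hρ0, hρtop] with x hx0 hxtop
    rw [← mul_assoc, ← ENNReal.mul_rpow_of_nonneg _ _ (by norm_num),
      ENNReal.inv_mul_cancel hx0 hxtop, ENNReal.one_rpow, one_mul]
  have hCS := ENNReal.lintegral_mul_le_Lp_mul_Lq μ Real.HolderConjugate.two_two
    (f := fun x => (ρ x)⁻¹ ^ (1 / 2 : ℝ)) (g := fun x => ρ x ^ (1 / 2 : ℝ) * a x)
    (by fun_prop) (by fun_prop)
  simp only [Pi.mul_apply, hmul, ENNReal.rpow_two, mul_pow, hsq] at hCS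
  calc (∫⁻ x, a x ∂μ) ^ 2 ≤ _ := pow_le_pow_left' hCS 2
    _ = _ := by rw [mul_pow, hsq, hsq]

theorem lintegral_le_rpow_mul_measure_univ_rpow {α : Type*} [MeasurableSpace α] {μ : Measure α}
    {q : ℝ} (hq : 1 < q) {w : α → ℝ≥0∞} (hw : AEMeasurable w μ) :
    ∫⁻ x, w x ∂μ ≤ (∫⁻ x, w x ^ q ∂μ) ^ (1 / q) * μ univ ^ (1 - 1 / q) := by
  have hconj : q.HolderConjugate (q / (q - 1)) := Real.HolderConjugate.conjExponent hq
  have hexp : 1 / (q / (q - 1)) = 1 - 1 / q := by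
    have : q - 1 ≠ 0 := by linarith
    field_simp
  rw [← hexp]
  simpa only [Pi.mul_apply, mul_one, ENNReal.one_rpow, lintegral_one] using
    ENNReal.lintegral_mul_le_Lp_mul_Lq μ hconj hw (aemeasurable_const (b := 1))

theorem lintegral_mul_lintegral_lintegral_mul {α β γ : Type*} [MeasurableSpace α]
    [MeasurableSpace β] [MeasurableSpace γ] {μ : Measure α} {ν : Measure β} {ξ : Measure γ}
    [SFinite μ] [SFinite ν] [SFinite ξ] {w : α → ℝ≥0∞} {τ : γ → ℝ≥0∞} {k : (α × γ) × β → ℝ≥0∞}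
    (hw : Measurable w) (hτ : Measurable τ) (hk : Measurable k) :
    ∫⁻ x, w x * ∫⁻ z, ∫⁻ t, τ t * k ((x, t), z) ∂ξ ∂ν ∂μ =
      ∫⁻ t, τ t * ∫⁻ x, w x * ∫⁻ z, k ((x, t), z) ∂ν ∂μ ∂ξ := by
  have _hmeas : Measurable fun p : α × γ => ∫⁻ z, k (p, z) ∂ν := hk.lintegral_prod_right'
  calc ∫⁻ x, w x * ∫⁻ z, ∫⁻ t, τ t * k ((x, t), z) ∂ξ ∂ν ∂μ
      = ∫⁻ x, ∫⁻ t, w x * (τ t * ∫⁻ z, k ((x, t), z) ∂ν) ∂ξ ∂μ := by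
        refine lintegral_congr fun x => ?_
        rw [lintegral_lintegral_swap (by fun_prop), ← lintegral_const_mul _ (by fun_prop)]
        refine lintegral_congr fun t => ?_
        rw [lintegral_const_mul _ (by fun_prop)]
    _ = ∫⁻ t, ∫⁻ x, w x * (τ t * ∫⁻ z, k ((x, t), z) ∂ν) ∂μ ∂ξ :=
        lintegral_lintegral_swap (by fun_prop)
    _ = ∫⁻ t, τ t * ∫⁻ x, w x * ∫⁻ z, k ((x, t), z) ∂ν ∂μ ∂ξ := by
        refine lintegral_congr fun t => ?_
        rw [← lintegral_const_mul _ (by fun_prop)]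
        exact lintegral_congr fun x => mul_left_comm _ _ _

theorem setLIntegral_mul_setLIntegral_closedBall {X : Type*} [PseudoMetricSpace X]
    [SecondCountableTopology X] [MeasurableSpace X] [OpensMeasurableSpace X] {μ : Measure X}
    [SFinite μ] {w g : X → ℝ≥0∞} (hw : Measurable w) (hg : Measurable g) (P : Set X) (r : ℝ) :
    ∫⁻ x in P, w x * ∫⁻ y in Metric.closedBall x r ∩ P, g y ∂μ ∂μ =
      ∫⁻ y in P, (∫⁻ x in Metric.closedBall y r ∩ P, w x ∂μ) * g y ∂μ := by
  classical
  have hball : ∀ x : X, MeasurableSet (Metric.closedBall x r) := fun x =>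
    Metric.isClosed_closedBall.measurableSet
  have hmeas : Measurable fun p : X × X =>
      {p : X × X | dist p.1 p.2 ≤ r}.indicator (fun p => w p.1 * g p.2) p :=
    (by fun_prop : Measurable fun p : X × X => w p.1 * g p.2).indicator
      (measurableSet_le (by fun_prop) (by fun_prop))
  calc ∫⁻ x in P, w x * ∫⁻ y in Metric.closedBall x r ∩ P, g y ∂μ ∂μ
      = ∫⁻ x in P, ∫⁻ y in P, {p : X × X | dist p.1 p.2 ≤ r}.indicator
          (fun p => w p.1 * g p.2) (x, y) ∂μ ∂μ := by
        refine lintegral_congr fun x => ?_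
        rw [← Measure.restrict_restrict (hball x), ← lintegral_indicator (hball x),
          ← lintegral_const_mul _ (hg.indicator (hball x))]
        refine lintegral_congr fun y => ?_
        simp [indicator_apply, dist_comm]
    _ = ∫⁻ y in P, ∫⁻ x in P, {p : X × X | dist p.1 p.2 ≤ r}.indicator
          (fun p => w p.1 * g p.2) (x, y) ∂μ ∂μ :=
        lintegral_lintegral_swap hmeas.aemeasurable
    _ = ∫⁻ y in P, (∫⁻ x in Metric.closedBall y r ∩ P, w x ∂μ) * g y ∂μ := by
        refine lintegral_congr fun y => ?_
        rw [← Measure.restrict_restrict (hball y), ← lintegral_indicator (hball y),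
          ← lintegral_mul_const _ (hw.indicator (hball y))]
        refine lintegral_congr fun x => ?_
        simp [indicator_apply]

variable {m : ℕ} {P : Set (Rm m)} {d : ℝ}

theorem setLIntegral_comp_homothety_le (hP : MeasurableSet P) (hconv : Convex ℝ P)
    (hdiam : ∀ x ∈ P, ∀ z ∈ P, ‖z - x‖ ≤ d) {g : Rm m → ℝ≥0∞} (hg : Measurable g) {x : Rm m}
    (hx : x ∈ P) {t : ℝ} (ht : t ∈ Ioc (0 : ℝ) 1) :
    ∫⁻ z in P, g (x + t • (z - x)) ≤
      ENNReal.ofReal ((t ^ m)⁻¹) * ∫⁻ y in Metric.closedBall x (t * d) ∩ P, g y := by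
  have hB : MeasurableSet (Metric.closedBall x (t * d) ∩ P) :=
    Metric.isClosed_closedBall.measurableSet.inter hP
  rw [← lintegral_indicator hB, ← lintegral_indicator hP]
  have hhom := lintegral_homothety volume (hg.indicator hB) x ht.1
  rw [finrank_euclideanSpace_fin] at hhom
  rw [← hhom]
  refine lintegral_mono (indicator_le fun z hz => ?_)
  have hmem : x + t • (z - x) ∈ Metric.closedBall x (t * d) ∩ P := by
    refine ⟨?_, hconv.add_smul_sub_mem hx hz (Ioc_subset_Icc_self ht)⟩
    rw [Metric.mem_closedBall, dist_eq_norm, add_sub_cancel_left, norm_smul,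
      Real.norm_of_nonneg ht.1.le]
    exact mul_le_mul_of_nonneg_left (hdiam x hx z hz) ht.1.le
  rw [indicator_of_mem hmem]

theorem setLIntegral_closedBall_inter_le {q : ℝ} (hq : 1 < q) {w : Rm m → ℝ≥0∞} (hw : Measurable w)
    (P : Set (Rm m)) (y : Rm m) {r : ℝ} (hr : 0 ≤ r) :
    ∫⁻ x in Metric.closedBall y r ∩ P, w x ≤
      (∫⁻ x in P, w x ^ q) ^ (1 / q) * (ENNReal.ofReal (r ^ (m * (1 - 1 / q))) *
        volume (Metric.ball (0 : Rm m) 1) ^ (1 - 1 / q)) := by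
  have hq1 : 0 ≤ 1 - 1 / q := by
    rw [sub_nonneg, div_le_one (by linarith)]
    exact hq.le
  have hball : ENNReal.ofReal (r ^ (m * (1 - 1 / q))) *
      volume (Metric.ball (0 : Rm m) 1) ^ (1 - 1 / q) =
        volume (Metric.closedBall y r) ^ (1 - 1 / q) := by
    rw [Measure.addHaar_closedBall volume y hr, ENNReal.mul_rpow_of_nonneg _ _ hq1,
      finrank_euclideanSpace_fin, ENNReal.ofReal_rpow_of_nonneg (by positivity) hq1,
      ← Real.rpow_natCast, ← Real.rpow_mul hr]
  rw [hball]
  refine (lintegral_le_rpow_mul_measure_univ_rpow hq hw.aemeasurable).trans ?_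
  rw [Measure.restrict_apply_univ]
  gcongr ?_ ^ _ * ?_ ^ _
  · exact lintegral_mono_set inter_subset_right
  · exact measure_mono inter_subset_left

theorem setLIntegral_mul_setLIntegral_comp_homothety_le (hP : MeasurableSet P)
    (hconv : Convex ℝ P) (hd : 0 ≤ d) (hdiam : ∀ x ∈ P, ∀ z ∈ P, ‖z - x‖ ≤ d) {q : ℝ} (hq : 1 < q)
    {w g : Rm m → ℝ≥0∞} (hw : Measurable w) (hg : Measurable g) {t : ℝ} (ht : t ∈ Ioc (0 : ℝ) 1) :
    ∫⁻ x in P, w x * ∫⁻ z in P, g (x + t • (z - x)) ≤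
      ENNReal.ofReal ((t ^ m)⁻¹) * ((∫⁻ x in P, w x ^ q) ^ (1 / q) *
        (ENNReal.ofReal ((t * d) ^ (m * (1 - 1 / q))) *
          volume (Metric.ball (0 : Rm m) 1) ^ (1 - 1 / q)) * ∫⁻ y in P, g y) := by
  calc ∫⁻ x in P, w x * ∫⁻ z in P, g (x + t • (z - x))
      ≤ ∫⁻ x in P, ENNReal.ofReal ((t ^ m)⁻¹) *
          (w x * ∫⁻ y in Metric.closedBall x (t * d) ∩ P, g y) := by
        refine setLIntegral_mono' hP fun x hx => ?_
        rw [mul_left_comm]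
        gcongr
        exact setLIntegral_comp_homothety_le hP hconv hdiam hg hx ht
    _ = ENNReal.ofReal ((t ^ m)⁻¹) *
          ∫⁻ y in P, (∫⁻ x in Metric.closedBall y (t * d) ∩ P, w x) * g y := by
        rw [lintegral_const_mul' _ _ ENNReal.ofReal_ne_top,
          setLIntegral_mul_setLIntegral_closedBall hw hg]
    _ ≤ _ := by
        rw [← lintegral_const_mul _ hg]
        gcongr with y
        exact setLIntegral_closedBall_inter_le hq hw P y (mul_nonneg ht.1.le hd)

/-- The constant of the weighted Poincaré inequality for functions on convex subsets of `ℝᵐ` and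
weights in `L^q`. It is finite when `m < 2 * q`. -/
def poincareConst (m : ℕ) (q : ℝ) : ℝ≥0∞ :=
  (∫⁻ t in Ioc (0 : ℝ) 1, ENNReal.ofReal (t ^ (-(m / (2 * q))))) ^ 2 *
    volume (Metric.ball (0 : Rm m) 1) ^ (1 - 1 / q)

theorem poincareConst_ne_top {q : ℝ} (hq : 1 < q) (hmq : m < 2 * q) : poincareConst m q ≠ ⊤ := by
  have hs : (m : ℝ) / (2 * q) < 1 := (div_lt_one (by linarith)).2 hmq
  refine ENNReal.mul_ne_top (ENNReal.pow_ne_top (lintegral_Ioc_rpow_ne_top (by linarith))) ?_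
  refine ENNReal.rpow_ne_top_of_nonneg ?_ measure_ball_lt_top.ne
  rw [sub_nonneg, div_le_one (by linarith)]
  exact hq.le

theorem setLIntegral_mul_setLIntegral_lintegral_rpow_mul_le (hP : MeasurableSet P)
    (hconv : Convex ℝ P) (hd : 0 < d) (hdiam : ∀ x ∈ P, ∀ z ∈ P, ‖z - x‖ ≤ d) {q : ℝ} (hq : 1 < q)
    {w g : Rm m → ℝ≥0∞} (hw : Measurable w) (hg : Measurable g) :
    (∫⁻ t in Ioc (0 : ℝ) 1, ENNReal.ofReal (t ^ (-(m / (2 * q))))) *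
      ∫⁻ x in P, w x * ∫⁻ z in P, ∫⁻ t in Ioc (0 : ℝ) 1,
        ENNReal.ofReal (t ^ (m / (2 * q))) * g (x + t • (z - x)) ≤
      poincareConst m q * ENNReal.ofReal (d ^ (m * (1 - 1 / q))) *
        (∫⁻ x in P, w x ^ q) ^ (1 / q) * ∫⁻ y in P, g y := by
  set s : ℝ := m / (2 * q)
  set A := ∫⁻ t in Ioc (0 : ℝ) 1, ENNReal.ofReal (t ^ (-s))
  set κ := volume (Metric.ball (0 : Rm m) 1) ^ (1 - 1 / q)
  set W := (∫⁻ x in P, w x ^ q) ^ (1 / q)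
  have hmeas : Measurable fun p : (Rm m × ℝ) × Rm m => g (p.1.1 + p.1.2 • (p.2 - p.1.1)) := by
    fun_prop
  have hpow : ∀ t ∈ Ioc (0 : ℝ) 1, ENNReal.ofReal (t ^ s) * (ENNReal.ofReal ((t ^ m)⁻¹) *
      ENNReal.ofReal ((t * d) ^ (m * (1 - 1 / q)))) =
        ENNReal.ofReal (t ^ (-s)) * ENNReal.ofReal (d ^ (m * (1 - 1 / q))) := by
    intro t ht
    have ht0 := ht.1
    rw [Real.mul_rpow ht0.le hd.le, ← ENNReal.ofReal_mul (by positivity),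
      ← ENNReal.ofReal_mul (by positivity), ← ENNReal.ofReal_mul (by positivity),
      ← mul_assoc, ← mul_assoc, ← Real.rpow_natCast t m, ← Real.rpow_neg ht0.le,
      ← Real.rpow_add ht0, ← Real.rpow_add ht0]
    congr 3
    simp only [s]
    field_simp
    ring
  rw [lintegral_mul_lintegral_lintegral_mul hw (by fun_prop) hmeas]
  calc A * ∫⁻ t in Ioc (0 : ℝ) 1,
        ENNReal.ofReal (t ^ s) * ∫⁻ x in P, w x * ∫⁻ z in P, g (x + t • (z - x))
      ≤ A * ∫⁻ t in Ioc (0 : ℝ) 1, ENNReal.ofReal (t ^ (-s)) *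
          (ENNReal.ofReal (d ^ (m * (1 - 1 / q))) * κ * W * ∫⁻ y in P, g y) := by
        refine mul_le_mul_right (setLIntegral_mono' measurableSet_Ioc fun t ht => ?_) _
        refine (mul_le_mul_right (setLIntegral_mul_setLIntegral_comp_homothety_le hP hconv hd.le
          hdiam hq hw hg ht) _).trans_eq ?_
        convert congrArg (· * (κ * W * ∫⁻ y in P, g y)) (hpow t ht) using 1 <;> ring
    _ = _ := by
        rw [lintegral_mul_const _ (by fun_prop), poincareConst]
        ring

/-- The squared Euclidean norm of the vector with components `G i y`. -/
def gradSq (G : Fin m → Rm m → ℝ) (y : Rm m) : ℝ≥0∞ :=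
  ENNReal.ofReal (∑ i, G i y ^ 2)

theorem measurable_gradSq {G : Fin m → Rm m → ℝ} (hG : ∀ i, Measurable (G i)) :
    Measurable (gradSq G) := by
  unfold gradSq
  fun_prop

theorem enorm_sum_mul_sq_le (e : Rm m) (G : Fin m → Rm m → ℝ) (y : Rm m) :
    ‖∑ i, e i * G i y‖ₑ ^ 2 ≤ ENNReal.ofReal (‖e‖ ^ 2) * gradSq G y := by
  rw [← ofReal_norm, ← ENNReal.ofReal_pow (norm_nonneg _), gradSq,
    ← ENNReal.ofReal_mul (by positivity), EuclideanSpace.real_norm_sq_eq, Real.norm_eq_abs, sq_abs]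
  exact ENNReal.ofReal_le_ofReal
    (Finset.sum_mul_sq_le_sq_mul_sq Finset.univ (fun i => e i) fun i => G i y)

namespace HasWeakPartials

variable {U : Set (Rm m)} {v : Rm m → ℝ} {G : Fin m → Rm m → ℝ}

theorem ae_ae_enorm_sub_le (h : HasWeakPartials U v G) (hU : IsOpen U) (hv : Measurable v)
    (hG : ∀ i, Measurable (G i)) :
    ∀ᵐ x, ∀ᵐ z, segment ℝ x z ⊆ U →
      ‖v z - v x‖ₑ ≤ ∫⁻ t in Ioc (0 : ℝ) 1, ‖∑ i, (z - x) i * G i (x + t • (z - x))‖ₑ := by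
  have hseg : IsOpen {p : Rm m × Rm m | segment ℝ p.1 (p.1 + p.2) ⊆ U} :=
    (isOpen_setOf_segment_subset hU).preimage
      (f := fun p : Rm m × Rm m => (p.1, p.1 + p.2)) (by fun_prop)
  have hI : Measurable fun p : Rm m × Rm m =>
      ∫⁻ t in Ioc (0 : ℝ) 1, ‖∑ i, p.2 i * G i (p.1 + t • p.2)‖ₑ :=
    Measurable.lintegral_prod_right'
      (f := fun z : (Rm m × Rm m) × ℝ => ‖∑ i, z.1.2 i * G i (z.1.1 + z.2 • z.1.2)‖ₑ) (by fun_prop)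
  have htranslate : ∀ᵐ x, ∀ᵐ e : Rm m, segment ℝ x (x + e) ⊆ U →
      ‖v (x + e) - v x‖ₑ ≤ ∫⁻ t in Ioc (0 : ℝ) 1, ‖∑ i, e i * G i (x + t • e)‖ₑ := by
    rw [Measure.ae_ae_comm (hseg.measurableSet.imp (measurableSet_le (by fun_prop) hI))]
    refine Eventually.of_forall fun e => ?_
    filter_upwards [h.ae_sub_eq_integral hU e] with x hx hs
    rw [hx hs, intervalIntegral.integral_of_le zero_le_one]
    exact enorm_integral_le_lintegral_enorm _
  filter_upwards [htranslate] with x hx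
  have hsub : Tendsto (fun z => z - x) (ae (volume : Measure (Rm m))) (ae volume) :=
    (measurePreserving_sub_right volume x).quasiMeasurePreserving.tendsto_ae
  filter_upwards [hsub.eventually hx] with z hz
  rwa [add_sub_cancel] at hz

theorem ae_ae_sq_sub_le (h : HasWeakPartials U v G) (hU : IsOpen U) (hv : Measurable v)
    (hG : ∀ i, Measurable (G i)) (s : ℝ) :
    ∀ᵐ x, ∀ᵐ z, segment ℝ x z ⊆ U →
      ENNReal.ofReal ((v x - v z) ^ 2) ≤ (∫⁻ t in Ioc (0 : ℝ) 1, ENNReal.ofReal (t ^ (-s))) *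
        (ENNReal.ofReal (‖z - x‖ ^ 2) *
          ∫⁻ t in Ioc (0 : ℝ) 1, ENNReal.ofReal (t ^ s) * gradSq G (x + t • (z - x))) := by
  have hweight : ∀ a : ℝ → ℝ≥0∞, Measurable a → (∫⁻ t in Ioc (0 : ℝ) 1, a t) ^ 2 ≤
      (∫⁻ t in Ioc (0 : ℝ) 1, ENNReal.ofReal (t ^ (-s))) *
        ∫⁻ t in Ioc (0 : ℝ) 1, ENNReal.ofReal (t ^ s) * a t ^ 2 := by
    intro a ha
    have hinv : ∫⁻ t in Ioc (0 : ℝ) 1, ENNReal.ofReal (t ^ (-s)) =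
        ∫⁻ t in Ioc (0 : ℝ) 1, (ENNReal.ofReal (t ^ s))⁻¹ :=
      setLIntegral_congr_fun measurableSet_Ioc fun t ht => by
        simp only [Real.rpow_neg ht.1.le, ENNReal.ofReal_inv_of_pos (Real.rpow_pos_of_pos ht.1 s)]
    rw [hinv]
    refine sq_lintegral_le_lintegral_inv_mul (by fun_prop) ha.aemeasurable ?_
      (Eventually.of_forall fun t => ENNReal.ofReal_ne_top)
    filter_upwards [ae_restrict_mem measurableSet_Ioc] with t ht
    exact (ENNReal.ofReal_pos.2 (Real.rpow_pos_of_pos ht.1 s)).ne'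
  filter_upwards [h.ae_ae_enorm_sub_le hU hv hG] with x hx
  filter_upwards [hx] with z hz hs
  calc ENNReal.ofReal ((v x - v z) ^ 2) = ‖v z - v x‖ₑ ^ 2 := by
        rw [← ofReal_norm, ← ENNReal.ofReal_pow (norm_nonneg _), Real.norm_eq_abs, sq_abs,
          sub_sq_comm]
    _ ≤ (∫⁻ t in Ioc (0 : ℝ) 1, ‖∑ i, (z - x) i * G i (x + t • (z - x))‖ₑ) ^ 2 := by
        gcongr
        exact hz hs
    _ ≤ _ := hweight _ (by fun_prop)
    _ ≤ _ := by
        gcongr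
        rw [← lintegral_const_mul' _ _ ENNReal.ofReal_ne_top]
        refine lintegral_mono fun t => ?_
        rw [mul_left_comm]
        gcongr
        exact enorm_sum_mul_sq_le _ _ _

theorem lintegral_lintegral_sq_sub_le (h : HasWeakPartials U v G) (hU : IsOpen U)
    (hv : Measurable v) (hG : ∀ i, Measurable (G i)) {q : ℝ} (hq : 1 < q) {w : Rm m → ℝ≥0∞}
    (hw : Measurable w) (hP : MeasurableSet P) (hconv : Convex ℝ P) (hd : 0 < d)
    (hdiam : ∀ x ∈ P, ∀ z ∈ P, ‖z - x‖ ≤ d)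
    (hseg : ∀ᵐ x, ∀ᵐ z, x ∈ P → z ∈ P → segment ℝ x z ⊆ U) :
    ∫⁻ z in P, ∫⁻ x in P, ENNReal.ofReal ((v x - v z) ^ 2) * w x ≤
      poincareConst m q * ENNReal.ofReal (d ^ (2 + m - m / q)) *
        (∫⁻ x in P, w x ^ q) ^ (1 / q) * ∫⁻ y in P, gradSq G y := by
  set s : ℝ := m / (2 * q)
  set A := ∫⁻ t in Ioc (0 : ℝ) 1, ENNReal.ofReal (t ^ (-s))
  have hgrad := measurable_gradSq hG
  have hmeas : Measurable fun p : (Rm m × Rm m) × ℝ =>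
      ENNReal.ofReal (p.2 ^ s) * gradSq G (p.1.1 + p.2 • (p.1.2 - p.1.1)) := by fun_prop
  have hmeas' : Measurable fun x => w x * ∫⁻ z in P, ∫⁻ t in Ioc (0 : ℝ) 1,
      ENNReal.ofReal (t ^ s) * gradSq G (x + t • (z - x)) :=
    hw.mul hmeas.lintegral_prod_right'.lintegral_prod_right'
  have hd2 : ENNReal.ofReal (d ^ 2) * ENNReal.ofReal (d ^ (m * (1 - 1 / q))) =
      ENNReal.ofReal (d ^ (2 + m - m / q)) := by
    rw [← ENNReal.ofReal_mul (by positivity), ← Real.rpow_natCast d 2, ← Real.rpow_add hd]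
    congr 2
    push_cast
    ring
  calc ∫⁻ z in P, ∫⁻ x in P, ENNReal.ofReal ((v x - v z) ^ 2) * w x
      = ∫⁻ x in P, ∫⁻ z in P, ENNReal.ofReal ((v x - v z) ^ 2) * w x :=
        lintegral_lintegral_swap (by fun_prop)
    _ ≤ ∫⁻ x in P, A * ENNReal.ofReal (d ^ 2) * (w x * ∫⁻ z in P, ∫⁻ t in Ioc (0 : ℝ) 1,
          ENNReal.ofReal (t ^ s) * gradSq G (x + t • (z - x))) := by
        refine lintegral_mono_ae ((ae_restrict_iff' hP).2 ?_)
        filter_upwards [h.ae_ae_sq_sub_le hU hv hG s, hseg] with x hx hxseg hxP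
        rw [← mul_assoc, ← lintegral_const_mul _ (by fun_prop)]
        refine lintegral_mono_ae ((ae_restrict_iff' hP).2 ?_)
        filter_upwards [hx, hxseg] with z hz hzseg hzP
        refine (mul_le_mul_left (hz (hzseg hxP hzP)) (w x)).trans ?_
        rw [mul_assoc A, mul_right_comm, ← mul_assoc, ← mul_assoc, mul_right_comm A,
          mul_right_comm A]
        gcongr
        exact hdiam x hxP z hzP
    _ = ENNReal.ofReal (d ^ 2) * (A * ∫⁻ x in P, w x * ∫⁻ z in P, ∫⁻ t in Ioc (0 : ℝ) 1,
          ENNReal.ofReal (t ^ s) * gradSq G (x + t • (z - x))) := by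
        rw [lintegral_const_mul _ hmeas', mul_comm A, mul_assoc]
    _ ≤ _ := by
        refine (mul_le_mul_right (setLIntegral_mul_setLIntegral_lintegral_rpow_mul_le hP hconv hd
          hdiam hq hw hgrad) _).trans_eq ?_
        rw [← hd2]
        ring

end HasWeakPartials

end WeightedPoincare

section LatticeCubes

variable {m : ℕ} {ℓ : ℝ}

/-- The half-open cube in `ℝᵐ` of side `ℓ` with lower corner `ℓ k`. -/
def latticeCube (ℓ : ℝ) (k : Fin m → ℤ) : Set (Rm m) :=
  {x | ∀ i, x i ∈ Ico (ℓ * k i) (ℓ * (k i + 1))}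

theorem latticeCube_eq_preimage_pi (ℓ : ℝ) (k : Fin m → ℤ) :
    latticeCube ℓ k =
      WithLp.ofLp ⁻¹' (univ.pi fun i => Ico (ℓ * k i) (ℓ * (k i + 1))) := by
  ext x
  simp [latticeCube]

theorem measurableSet_latticeCube (ℓ : ℝ) (k : Fin m → ℤ) : MeasurableSet (latticeCube ℓ k) := by
  rw [latticeCube_eq_preimage_pi]
  exact (MeasurableSet.univ_pi fun i => measurableSet_Ico).preimage
    (PiLp.volume_preserving_ofLp (Fin m)).measurable

theorem volume_latticeCube (hℓ : 0 ≤ ℓ) (k : Fin m → ℤ) :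
    volume (latticeCube ℓ k) = ENNReal.ofReal (ℓ ^ m) := by
  have hside : ∀ i, ℓ * ((k i : ℝ) + 1) - ℓ * k i = ℓ := fun i => by ring
  rw [latticeCube_eq_preimage_pi, (PiLp.volume_preserving_ofLp (Fin m)).measure_preimage
    (MeasurableSet.univ_pi fun i => measurableSet_Ico).nullMeasurableSet, Real.volume_pi_Ico]
  simp [hside, ENNReal.ofReal_pow hℓ]

theorem convex_latticeCube (ℓ : ℝ) (k : Fin m → ℤ) : Convex ℝ (latticeCube ℓ k) :=
  fun _ hx _ hy _ _ ha hb hab i => convex_Ico _ _ (hx i) (hy i) ha hb hab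

theorem mem_latticeCube_iff (hℓ : 0 < ℓ) {k : Fin m → ℤ} {x : Rm m} :
    x ∈ latticeCube ℓ k ↔ (fun i => ⌊x i / ℓ⌋) = k := by
  simp only [latticeCube, funext_iff, Int.floor_eq_iff, le_div_iff₀ hℓ, div_lt_iff₀ hℓ,
    mul_comm _ ℓ, mem_Ico]
  rfl

theorem pairwise_disjoint_latticeCube (hℓ : 0 < ℓ) :
    Pairwise (Function.onFun Disjoint (latticeCube (m := m) ℓ)) := fun _ _ hne =>
  Set.disjoint_left.2 fun _ hx hx' =>
    hne (((mem_latticeCube_iff hℓ).1 hx).symm.trans ((mem_latticeCube_iff hℓ).1 hx'))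

theorem norm_sub_le_of_mem_latticeCube (hℓ : 0 ≤ ℓ) {k : Fin m → ℤ} {x z : Rm m}
    (hx : x ∈ latticeCube ℓ k) (hz : z ∈ latticeCube ℓ k) : ‖z - x‖ ≤ m * ℓ := by
  have hcoord : ∀ i, ((z - x) i) ^ 2 ≤ ℓ ^ 2 := fun i =>
    sq_le_sq' (by rw [PiLp.sub_apply]; linarith [(hx i).2, (hz i).1])
      (by rw [PiLp.sub_apply]; linarith [(hx i).1, (hz i).2])
  have hm : (m : ℝ) ≤ (m : ℝ) ^ 2 := by exact_mod_cast Nat.le_self_pow two_ne_zero m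
  refine le_of_sq_le_sq ?_ (by positivity)
  calc ‖z - x‖ ^ 2 = ∑ i, ((z - x) i) ^ 2 := EuclideanSpace.real_norm_sq_eq _
    _ ≤ ∑ _i : Fin m, ℓ ^ 2 := Finset.sum_le_sum fun i _ => hcoord i
    _ = m * ℓ ^ 2 := by simp
    _ ≤ (m * ℓ) ^ 2 := by rw [mul_pow]; gcongr

theorem latticeCube_subset_closedBall (hℓ : 0 ≤ ℓ) {k : Fin m → ℤ} {y : Rm m} {r : ℝ}
    (hk : (latticeCube ℓ k ∩ Metric.closedBall y r).Nonempty) :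
    latticeCube ℓ k ⊆ Metric.closedBall y (m * ℓ + r) := by
  obtain ⟨x, hxk, hxy⟩ := hk
  intro z hz
  refine (dist_triangle z x y).trans (add_le_add ?_ hxy)
  exact (dist_eq_norm z x).trans_le (norm_sub_le_of_mem_latticeCube hℓ hxk hz)

theorem finite_setOf_latticeCube_inter_nonempty (hℓ : 0 < ℓ) (y : Rm m) (r : ℝ) :
    {k : Fin m → ℤ | (latticeCube ℓ k ∩ Metric.closedBall y r).Nonempty}.Finite := by
  refine (Set.finite_Icc (fun i => ⌊(y i - r) / ℓ⌋) fun i => ⌊(y i + r) / ℓ⌋).subset ?_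
  rintro k ⟨x, hxk, hxy⟩
  have hcoord : ∀ i, |x i - y i| ≤ r := fun i =>
    (PiLp.norm_apply_le (x - y) i).trans (mem_closedBall_iff_norm.1 hxy)
  rw [← (mem_latticeCube_iff hℓ).1 hxk]
  exact ⟨fun i => Int.floor_le_floor (by gcongr; linarith [(abs_le.1 (hcoord i)).1]),
    fun i => Int.floor_le_floor (by gcongr; linarith [(abs_le.1 (hcoord i)).2])⟩

end LatticeCubes

section CubeEstimate

variable {m : ℕ} {U P : Set (Rm m)} {v : Rm m → ℝ} {G : Fin m → Rm m → ℝ} {q d ℓ : ℝ}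
  {w : Rm m → ℝ≥0∞}

namespace HasWeakPartials

theorem congr {v' : Rm m → ℝ} {G' : Fin m → Rm m → ℝ} (h : HasWeakPartials U v G)
    (hv : v =ᵐ[volume.restrict U] v') (hG : ∀ i, G i =ᵐ[volume.restrict U] G' i) :
    HasWeakPartials U v' G' := by
  have hloc : ∀ {a b : Rm m → ℝ}, a =ᵐ[volume.restrict U] b → LocallyIntegrableOn a U volume →
      LocallyIntegrableOn b U volume := by
    intro a b hab ha x hx
    obtain ⟨t, ht, hat⟩ := ha x hx
    exact ⟨t ∩ U, inter_mem ht self_mem_nhdsWithin, (hat.mono_set inter_subset_left).congr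
      (ae_restrict_of_ae_restrict_of_subset inter_subset_right hab)⟩
  refine ⟨hloc hv h.1, fun i => ⟨hloc (hG i) (h.2 i).1, fun ψ hψ hc hs => ?_⟩⟩
  refine (integral_congr_ae ?_).trans (((h.2 i).2 ψ hψ hc hs).trans
    (congrArg _ (integral_congr_ae ?_)))
  · filter_upwards [hv] with y hy using by rw [hy]
  · filter_upwards [hG i] with y hy using by rw [hy]

/-- The constant is the value of `v` at a point where the weighted mean square distance of `v` to
that value is at most average. -/
theorem exists_lintegral_sq_sub_le_of_measurable (h : HasWeakPartials U v G) (hU : IsOpen U)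
    (hv : Measurable v) (hG : ∀ i, Measurable (G i)) (hq : 1 < q) (hw : Measurable w)
    (hP : MeasurableSet P) (hP0 : volume P ≠ 0) (hPtop : volume P ≠ ⊤) (hconv : Convex ℝ P)
    (hd : 0 < d) (hdiam : ∀ x ∈ P, ∀ z ∈ P, ‖z - x‖ ≤ d)
    (hseg : ∀ᵐ x, ∀ᵐ z, x ∈ P → z ∈ P → segment ℝ x z ⊆ U) :
    ∃ c : ℝ, ∫⁻ x in P, ENNReal.ofReal ((v x - c) ^ 2) * w x ≤
      poincareConst m q * ENNReal.ofReal (d ^ (2 + m - m / q)) / volume P *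
        (∫⁻ x in P, w x ^ q) ^ (1 / q) * ∫⁻ y in P, gradSq G y := by
  have hmeas : Measurable fun z => ∫⁻ x in P, ENNReal.ofReal ((v x - v z) ^ 2) * w x :=
    Measurable.lintegral_prod_right'
      (f := fun p : Rm m × Rm m => ENNReal.ofReal ((v p.2 - v p.1) ^ 2) * w p.2) (by fun_prop)
  obtain ⟨z, -, hz⟩ := exists_le_setLAverage hP0 hPtop hmeas.aemeasurable
  refine ⟨v z, hz.trans ?_⟩
  rw [setLAverage_eq]
  refine (ENNReal.div_le_div_right (h.lintegral_lintegral_sq_sub_le hU hv hG hq hw hP hconv hd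
    hdiam hseg) _).trans_eq ?_
  simp only [div_eq_mul_inv]
  ring

theorem exists_lintegral_sq_sub_le (h : HasWeakPartials U v G) (hU : IsOpen U) (hq : 1 < q)
    (hw : AEMeasurable w (volume.restrict U)) (hP : MeasurableSet P) (hP0 : volume P ≠ 0)
    (hPtop : volume P ≠ ⊤) (hconv : Convex ℝ P) (hd : 0 < d)
    (hdiam : ∀ x ∈ P, ∀ z ∈ P, ‖z - x‖ ≤ d)
    (hseg : ∀ᵐ x, ∀ᵐ z, x ∈ P → z ∈ P → segment ℝ x z ⊆ U) :
    ∃ c : ℝ, ∫⁻ x in P ∩ U, ENNReal.ofReal ((v x - c) ^ 2) * w x ≤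
      poincareConst m q * ENNReal.ofReal (d ^ (2 + m - m / q)) / volume P *
        (∫⁻ x in P ∩ U, w x ^ q) ^ (1 / q) * ∫⁻ y in P ∩ U, gradSq G y := by
  have hUm := hU.measurableSet
  have hva : AEMeasurable v (volume.restrict U) := h.1.aestronglyMeasurable.aemeasurable
  have hGa : ∀ i, AEMeasurable (G i) (volume.restrict U) := fun i =>
    (h.2 i).1.aestronglyMeasurable.aemeasurable
  have hGeq : ∀ i, G i =ᵐ[volume.restrict U] U.indicator ((hGa i).mk (G i)) := fun i =>
    (hGa i).ae_eq_mk.trans (indicator_ae_eq_restrict hUm).symm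
  have hweq : w =ᵐ[volume.restrict U] U.indicator (hw.mk w) :=
    hw.ae_eq_mk.trans (indicator_ae_eq_restrict hUm).symm
  have hrestrict : ∀ {k k' : Rm m → ℝ≥0∞}, k =ᵐ[volume.restrict U] k' → (∀ x ∉ U, k' x = 0) →
      ∫⁻ x in P, k' x = ∫⁻ x in P ∩ U, k x := by
    intro k k' hk h0
    rw [← indicator_eq_self.2 (Function.support_subset_iff'.2 h0), setLIntegral_indicator hUm,
      inter_comm]
    exact lintegral_congr_ae (ae_restrict_of_ae_restrict_of_subset inter_subset_right hk.symm)
  obtain ⟨c, hc⟩ := (h.congr hva.ae_eq_mk hGeq).exists_lintegral_sq_sub_le_of_measurable hU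
    hva.measurable_mk (fun i => (hGa i).measurable_mk.indicator hUm) hq
    (hw.measurable_mk.indicator hUm) hP hP0 hPtop hconv hd hdiam hseg
  refine ⟨c, ?_⟩
  rwa [hrestrict (k := fun x => ENNReal.ofReal ((v x - c) ^ 2) * w x)
      (by filter_upwards [hva.ae_eq_mk, hweq] with x hvx hwx; rw [hvx, hwx])
      fun x hx => by simp [hx],
    hrestrict (k := fun x => w x ^ q) (by filter_upwards [hweq] with x hwx; rw [hwx])
      fun x hx => by simp [hx, zero_lt_one.trans hq],
    hrestrict (k := gradSq G)
      (by filter_upwards [ae_all_iff.2 hGeq] with x hGx; simp only [gradSq, hGx])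
      fun x hx => by simp [hx, gradSq]] at hc

theorem exists_lintegral_latticeCube_sq_sub_le (h : HasWeakPartials U v G) (hm : 0 < m)
    (hU : IsOpen U) (hq : 1 < q) (hw : AEMeasurable w (volume.restrict U)) (hℓ : 0 < ℓ)
    (k : Fin m → ℤ)
    (hseg : ∀ᵐ x, ∀ᵐ z, x ∈ latticeCube ℓ k → z ∈ latticeCube ℓ k → segment ℝ x z ⊆ U) :
    ∃ c : ℝ, ∫⁻ x in latticeCube ℓ k ∩ U, ENNReal.ofReal ((v x - c) ^ 2) * w x ≤
      poincareConst m q * ENNReal.ofReal (m ^ (2 + m - m / q)) *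
        ENNReal.ofReal (ℓ ^ (2 - m / q)) * (∫⁻ x in latticeCube ℓ k ∩ U, w x ^ q) ^ (1 / q) *
          ∫⁻ y in latticeCube ℓ k ∩ U, gradSq G y := by
  have hm' : (0 : ℝ) < m := Nat.cast_pos.2 hm
  have hvol := volume_latticeCube hℓ.le k
  have hvol0 : ENNReal.ofReal (ℓ ^ m) ≠ 0 := (ENNReal.ofReal_pos.2 (by positivity)).ne'
  have hscale : ENNReal.ofReal ((m * ℓ) ^ (2 + m - m / q)) = ENNReal.ofReal (ℓ ^ m) *
      (ENNReal.ofReal (m ^ (2 + m - m / q)) * ENNReal.ofReal (ℓ ^ (2 - m / q))) := by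
    rw [← ENNReal.ofReal_mul (by positivity), ← ENNReal.ofReal_mul (by positivity),
      Real.mul_rpow hm'.le hℓ.le, mul_left_comm, ← Real.rpow_natCast ℓ m, ← Real.rpow_add hℓ]
    congr 3
    ring
  obtain ⟨c, hc⟩ := h.exists_lintegral_sq_sub_le hU hq hw (measurableSet_latticeCube ℓ k)
    (hvol ▸ hvol0) (hvol ▸ ENNReal.ofReal_ne_top) (convex_latticeCube ℓ k) (d := m * ℓ)
    (by positivity) (fun x hx z hz => norm_sub_le_of_mem_latticeCube hℓ.le hx hz) hseg
  refine ⟨c, hc.trans_eq ?_⟩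
  rw [hvol, hscale, mul_left_comm, mul_comm (ENNReal.ofReal (ℓ ^ m)),
    ENNReal.mul_div_cancel_right hvol0 ENNReal.ofReal_ne_top, ← mul_assoc (poincareConst m q)]

theorem exists_lintegral_latticeCube_sq_sub_le_of_subset (h : HasWeakPartials U v G) (hm : 0 < m)
    (hU : IsOpen U) (hq : 1 < q) (hw : AEMeasurable w (volume.restrict U)) (hℓ : 0 < ℓ)
    {k : Fin m → ℤ} {B : Set (Rm m)} (hB : latticeCube ℓ k ⊆ B)
    (hseg : ∀ᵐ x, ∀ᵐ z, x ∈ B → z ∈ B → segment ℝ x z ⊆ U) {η : ℝ≥0∞}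
    (hη : poincareConst m q * ENNReal.ofReal (m ^ (2 + m - m / q)) *
      (∫⁻ x in B ∩ U, w x ^ q) ^ (1 / q) * ENNReal.ofReal (ℓ ^ (2 - m / q)) ≤ η) :
    ∃ c : ℝ, ∫⁻ x in latticeCube ℓ k ∩ U, ENNReal.ofReal ((v x - c) ^ 2) * w x ≤
      η * ∫⁻ y in latticeCube ℓ k ∩ U, gradSq G y := by
  obtain ⟨c, hc⟩ := h.exists_lintegral_latticeCube_sq_sub_le hm hU hq hw hℓ k (by
    filter_upwards [hseg] with x hx
    filter_upwards [hx] with z hz hxk hzk using hz (hB hxk) (hB hzk))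
  refine ⟨c, hc.trans (mul_le_mul_left (le_trans ?_ hη) _)⟩
  rw [mul_right_comm]
  gcongr

end HasWeakPartials

theorem exists_pos_mul_le_and_mul_ofReal_rpow_le {C η : ℝ≥0∞} (hC : C ≠ ⊤) (hη : η ≠ 0)
    {a r s : ℝ} (hr : 0 < r) (hs : 0 < s) :
    ∃ ℓ > 0, a * ℓ ≤ r ∧ C * ENNReal.ofReal (ℓ ^ s) ≤ η := by
  have hpow : Tendsto (fun ℓ : ℝ => C * ENNReal.ofReal (ℓ ^ s)) (𝓝 0) (𝓝 0) := by
    have h := ENNReal.Tendsto.const_mul (ENNReal.tendsto_ofReal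
      (Real.continuousAt_rpow_const 0 s (Or.inr hs.le)).tendsto) (Or.inr hC)
    simpa only [Real.zero_rpow hs.ne', ENNReal.ofReal_zero, mul_zero] using h
  have hlin : Tendsto (fun ℓ : ℝ => a * ℓ) (𝓝 0) (𝓝 0) := by
    simpa only [mul_zero] using (continuous_const_mul a).tendsto (0 : ℝ)
  obtain ⟨ℓ, ⟨hℓr, hℓη⟩, hℓ⟩ := (((hlin.eventually_le_const hr).and
    (hpow.eventually_le_const (pos_iff_ne_zero.2 hη))).filter_mono
      (nhdsWithin_le_nhds (s := Ioi 0)) |>.and self_mem_nhdsWithin).exists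
  exact ⟨ℓ, hℓ, hℓr, hℓη⟩

theorem exists_finite_partition_lintegral_sq_sub_le (hm : 0 < m) (hq : 1 < q) (hmq : m < 2 * q)
    (hU : IsOpen U) (hw : AEMeasurable w (volume.restrict U)) {y₀ : Rm m} {r : ℝ} (hr : 0 < r)
    (hwq : ∫⁻ x in Metric.closedBall y₀ (2 * r) ∩ U, w x ^ q ≠ ⊤)
    (hseg : ∀ᵐ x, ∀ᵐ z, x ∈ Metric.closedBall y₀ (2 * r) → z ∈ Metric.closedBall y₀ (2 * r) →
      segment ℝ x z ⊆ U) {η : ℝ≥0∞} (hη : η ≠ 0) :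
    ∃ (T : Finset (Fin m → ℤ)) (P : (Fin m → ℤ) → Set (Rm m)),
      (∀ k, MeasurableSet (P k)) ∧ Metric.closedBall y₀ r ⊆ ⋃ k ∈ T, P k ∧
      (∀ k ∈ T, P k ⊆ Metric.closedBall y₀ (2 * r)) ∧
      ∀ {v : Rm m → ℝ} {G : Fin m → Rm m → ℝ}, HasWeakPartials U v G → ∃ c : (Fin m → ℤ) → ℝ,
        ∑ k ∈ T, ∫⁻ x in P k ∩ U, ENNReal.ofReal ((v x - c k) ^ 2) * w x ≤
          η * ∫⁻ y in Metric.closedBall y₀ (2 * r) ∩ U, gradSq G y := by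
  set B := Metric.closedBall y₀ (2 * r)
  set W := (∫⁻ x in B ∩ U, w x ^ q) ^ (1 / q)
  set C := poincareConst m q * ENNReal.ofReal (m ^ (2 + m - m / q))
  have hq0 : 0 < q := zero_lt_one.trans hq
  have hCW : C * W ≠ ⊤ :=
    ENNReal.mul_ne_top (ENNReal.mul_ne_top (poincareConst_ne_top hq hmq) ENNReal.ofReal_ne_top)
      (ENNReal.rpow_ne_top_of_nonneg (by positivity) hwq)
  obtain ⟨ℓ, hℓ, hℓr, hℓη⟩ := exists_pos_mul_le_and_mul_ofReal_rpow_le hCW hη (a := m) hr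
    (sub_pos.2 ((div_lt_iff₀ hq0).2 hmq))
  have hfin := finite_setOf_latticeCube_inter_nonempty hℓ y₀ r
  have hsub : ∀ k ∈ hfin.toFinset, latticeCube ℓ k ⊆ B := fun k hk =>
    (latticeCube_subset_closedBall hℓ.le (hfin.mem_toFinset.1 hk)).trans
      (Metric.closedBall_subset_closedBall (by linarith))
  refine ⟨hfin.toFinset, latticeCube ℓ, measurableSet_latticeCube ℓ, fun x hx => ?_, hsub, ?_⟩
  · have hxk := (mem_latticeCube_iff hℓ (x := x)).2 rfl
    exact mem_iUnion₂.2 ⟨_, hfin.mem_toFinset.2 ⟨x, hxk, hx⟩, hxk⟩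
  intro v G h
  have hcube : ∀ k, ∃ c : ℝ, k ∈ hfin.toFinset →
      ∫⁻ x in latticeCube ℓ k ∩ U, ENNReal.ofReal ((v x - c) ^ 2) * w x ≤
        η * ∫⁻ y in latticeCube ℓ k ∩ U, gradSq G y := by
    intro k
    by_cases hk : k ∈ hfin.toFinset
    · obtain ⟨c, hc⟩ := h.exists_lintegral_latticeCube_sq_sub_le_of_subset hm hU hq hw hℓ
        (hsub k hk) hseg hℓη
      exact ⟨c, fun _ => hc⟩
    · exact ⟨0, fun hk' => absurd hk' hk⟩
  choose c hc using hcube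
  refine ⟨c, (Finset.sum_le_sum hc).trans ?_⟩
  rw [← Finset.mul_sum, ← lintegral_biUnion_finset
    (fun k _ k' _ hne => (pairwise_disjoint_latticeCube hℓ hne).mono inter_subset_left
      inter_subset_left)
    fun k _ => (measurableSet_latticeCube ℓ k).inter hU.measurableSet]
  gcongr
  exact iUnion₂_subset fun k hk => inter_subset_inter_left _ (hsub k hk)

end CubeEstimate

section Charts

variable {m : ℕ} {X : Type*} [TopologicalSpace X] [ChartedSpace (Rm m) X]
  {φ φ' : OpenPartialHomeomorph X (Rm m)}

theorem mdifferentiable_of_mem_maximalAtlas (hφ : φ ∈ IsManifold.maximalAtlas (𝓡 m) ∞ X) :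
    φ.MDifferentiable (𝓡 m) (𝓡 m) :=
  ⟨(contMDiffOn_of_mem_maximalAtlas hφ).mdifferentiableOn (by simp),
    (contMDiffOn_symm_of_mem_maximalAtlas hφ).mdifferentiableOn (by simp)⟩

theorem differentiableAt_transition (hφ : φ ∈ IsManifold.maximalAtlas (𝓡 m) ∞ X)
    (hφ' : φ' ∈ IsManifold.maximalAtlas (𝓡 m) ∞ X) {y : Rm m} (hy : y ∈ φ.target)
    (hy' : φ.symm y ∈ φ'.source) : DifferentiableAt ℝ (φ' ∘ φ.symm) y :=
  mdifferentiableAt_iff_differentiableAt.1 <|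
    ((mdifferentiable_of_mem_maximalAtlas hφ').mdifferentiableAt hy').comp y
      ((mdifferentiable_of_mem_maximalAtlas hφ).mdifferentiableAt_symm hy)

theorem mfderiv_symm_eq_mfderiv_symm_fderiv_transition
    (hφ : φ ∈ IsManifold.maximalAtlas (𝓡 m) ∞ X) (hφ' : φ' ∈ IsManifold.maximalAtlas (𝓡 m) ∞ X)
    {y : Rm m} (hy : y ∈ φ.target) (hy' : φ.symm y ∈ φ'.source) (a : Rm m) :
    (mfderiv (𝓡 m) (𝓡 m) φ.symm y a : Rm m) =
      mfderiv (𝓡 m) (𝓡 m) φ'.symm (φ' (φ.symm y)) (fderiv ℝ (φ' ∘ φ.symm) y a : Rm m) := by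
  have heq : φ.symm =ᶠ[𝓝 y] φ'.symm ∘ (φ' ∘ φ.symm) := by
    filter_upwards [(φ.symm.continuousAt hy).preimage_mem_nhds (φ'.open_source.mem_nhds hy')]
      with z hz using (φ'.left_inv hz).symm
  have hchain := mfderiv_comp y (I'' := 𝓡 m)
    ((mdifferentiable_of_mem_maximalAtlas hφ').mdifferentiableAt_symm (φ'.map_source hy'))
    (differentiableAt_transition hφ hφ' hy hy').mdifferentiableAt
  rw [heq.mfderiv_eq, hchain, mfderiv_eq_fderiv]
  rfl

variable [IsManifold (𝓡 m) ∞ X]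

theorem inner_mfderiv_symm_eq_sum (h : SmoothMetric m X) (φ : OpenPartialHomeomorph X (Rm m))
    (y a b : Rm m) :
    h.inner (φ.symm y) (mfderiv (𝓡 m) (𝓡 m) φ.symm y a) (mfderiv (𝓡 m) (𝓡 m) φ.symm y b) =
      ∑ k, ∑ l, a k * gram h φ y k l * b l := by
  have hexpand : ∀ a : Rm m, mfderiv (𝓡 m) (𝓡 m) φ.symm y a = ∑ i, a i • coordVec φ y i := by
    intro a
    have ha := (EuclideanSpace.basisFun (Fin m) ℝ).sum_repr a
    simp only [EuclideanSpace.basisFun_repr, EuclideanSpace.basisFun_apply] at ha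
    conv_lhs => rw [← ha]
    exact (map_sum (mfderiv (𝓡 m) (𝓡 m) φ.symm y) _ _).trans
      (Finset.sum_congr rfl fun i _ => map_smul (mfderiv (𝓡 m) (𝓡 m) φ.symm y) _ _)
  rw [hexpand a, hexpand b]
  simp only [map_sum, map_smul, sum_apply, smul_apply, smul_eq_mul, gram, Matrix.of_apply]
  rw [Finset.sum_comm]
  refine Finset.sum_congr rfl fun k _ => ?_
  rw [Finset.mul_sum]
  exact Finset.sum_congr rfl fun l _ => by ring

theorem inner_self_nonneg_of_smoothMetric (h : SmoothMetric m X) {q : X}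
    (v : TangentSpace (𝓡 m) q) : 0 ≤ h.inner q v v := by
  rcases eq_or_ne v 0 with rfl | hv
  · simp
  · exact (h.pos q v hv).le

theorem sq_inner_coordVec_le (h : SmoothMetric m X) (φ : OpenPartialHomeomorph X (Rm m)) (y : Rm m)
    (i : Fin m) (Z : TangentSpace (𝓡 m) (φ.symm y)) :
    h.inner (φ.symm y) Z (coordVec φ y i) ^ 2 ≤ h.inner (φ.symm y) Z Z * gram h φ y i i :=
  LinearMap.BilinForm.apply_sq_le_of_symm (h.inner (φ.symm y)).toBilinForm
    (inner_self_nonneg_of_smoothMetric h) ⟨h.symm _⟩ Z (coordVec φ y i)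

theorem gram_posDef (h : SmoothMetric m X) (hφ : φ ∈ IsManifold.maximalAtlas (𝓡 m) ∞ X)
    {y : Rm m} (hy : y ∈ φ.target) : (gram h φ y).PosDef := by
  refine Matrix.PosDef.of_dotProduct_mulVec_pos ?_ fun x hx => ?_
  · ext i j
    simp [gram, h.symm _ (coordVec φ y i)]
  have hform : star x ⬝ᵥ (gram h φ y).mulVec x = ∑ k, ∑ l, x k * gram h φ y k l * x l := by
    simp only [dotProduct, Matrix.mulVec, Pi.star_apply, star_trivial, Finset.mul_sum, mul_assoc]
  rw [hform, ← inner_mfderiv_symm_eq_sum h φ y (WithLp.toLp 2 x) (WithLp.toLp 2 x)]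
  refine h.pos _ _ fun hzero => hx ?_
  have hx0 : (WithLp.toLp 2 x : Rm m) = 0 :=
    (mdifferentiable_of_mem_maximalAtlas hφ).symm.mfderiv_injective hy
      (hzero.trans (map_zero _).symm)
  simpa using hx0

theorem gram_eq_transpose_mul_gram_mul (h : SmoothMetric m X)
    (hφ : φ ∈ IsManifold.maximalAtlas (𝓡 m) ∞ X) (hφ' : φ' ∈ IsManifold.maximalAtlas (𝓡 m) ∞ X)
    {y : Rm m} (hy : y ∈ φ.target) (hy' : φ.symm y ∈ φ'.source) {J : Matrix (Fin m) (Fin m) ℝ}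
    (hJ : ∀ k i, J k i = fderiv ℝ (φ' ∘ φ.symm) y (EuclideanSpace.single i 1) k) :
    gram h φ y = J.transpose * gram h φ' (φ' (φ.symm y)) * J := by
  have hbase : ∀ {q q' : X}, q = q' → ∀ a b : Rm m,
      h.inner q (show TangentSpace (𝓡 m) q from a) (show TangentSpace (𝓡 m) q from b) =
        h.inner q' (show TangentSpace (𝓡 m) q' from a) (show TangentSpace (𝓡 m) q' from b) := by
    rintro q _ rfl a b
    rfl
  ext i j
  have hij : gram h φ y i j = _ := (hbase (φ'.left_inv hy').symm _ _).trans <|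
    (congrArg₂ (fun s t : Rm m => h.inner (φ'.symm (φ' (φ.symm y)))
      (show TangentSpace (𝓡 m) (φ'.symm (φ' (φ.symm y))) from s)
      (show TangentSpace (𝓡 m) (φ'.symm (φ' (φ.symm y))) from t))
        (mfderiv_symm_eq_mfderiv_symm_fderiv_transition hφ hφ' hy hy' _)
        (mfderiv_symm_eq_mfderiv_symm_fderiv_transition hφ hφ' hy hy' _)).trans
          (inner_mfderiv_symm_eq_sum h φ' _ _ _)
  simp only [hij, Matrix.mul_apply, Matrix.transpose_apply, Finset.sum_mul, hJ]
  exact Finset.sum_comm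

theorem sqrt_det_gram_eq (h : SmoothMetric m X)
    (hφ : φ ∈ IsManifold.maximalAtlas (𝓡 m) ∞ X) (hφ' : φ' ∈ IsManifold.maximalAtlas (𝓡 m) ∞ X)
    {y : Rm m} (hy : y ∈ φ.target) (hy' : φ.symm y ∈ φ'.source) :
    √(gram h φ y).det = |(fderiv ℝ (φ' ∘ φ.symm) y).det| *
      √(gram h φ' (φ' (φ.symm y))).det := by
  set L := fderiv ℝ (φ' ∘ φ.symm) y
  let b := (EuclideanSpace.basisFun (Fin m) ℝ).toBasis
  have hdet : (LinearMap.toMatrix b b (L : Rm m →ₗ[ℝ] Rm m)).det = L.det :=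
    LinearMap.det_toMatrix b _
  rw [gram_eq_transpose_mul_gram_mul h hφ hφ' hy hy' (J := LinearMap.toMatrix b b L)
      fun k i => by simp [b, L, LinearMap.toMatrix_apply],
    Matrix.det_mul, Matrix.det_mul, Matrix.det_transpose, hdet, mul_right_comm, ← sq,
    Real.sqrt_mul (sq_nonneg _), Real.sqrt_sq_eq_abs]

theorem contMDiffOn_coordVec (hφ : φ ∈ IsManifold.maximalAtlas (𝓡 m) ∞ X) (i : Fin m) :
    ContMDiffOn (𝓡 m) (𝓡 m).tangent 0
      (fun y => (⟨φ.symm y, coordVec φ y i⟩ : TangentBundle (𝓡 m) X)) φ.target := by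
  have htangent := (contMDiffOn_symm_of_mem_maximalAtlas hφ).contMDiffOn_tangentMapWithin (m := 0)
    (by simp) φ.open_target.uniqueMDiffOn
  have hconst : ContMDiff (𝓡 m) (𝓡 m).tangent 0
      (fun y : Rm m => (⟨y, EuclideanSpace.single i (1 : ℝ)⟩ : TangentBundle (𝓡 m) (Rm m))) :=
    contMDiff_zero_iff.2 <| (tangentBundleModelSpaceHomeomorph (𝓡 m)).symm.continuous.comp
      (continuous_id.prodMk continuous_const)
  refine (htangent.comp hconst.contMDiffOn fun y hy => hy).congr fun y hy => ?_
  simp only [Function.comp, tangentMapWithin, coordVec]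
  rw [mfderivWithin_of_isOpen φ.open_target hy]

theorem continuousOn_gram (h : SmoothMetric m X) (hφ : φ ∈ IsManifold.maximalAtlas (𝓡 m) ∞ X) :
    ContinuousOn (gram h φ) φ.target := by
  refine continuousOn_pi.2 fun i => continuousOn_pi.2 fun j => ?_
  have hentry : ContMDiffOn (𝓡 m) ((𝓡 m).prod 𝓘(ℝ)) 0
      (fun y => Bundle.TotalSpace.mk' ℝ (E := Bundle.Trivial X ℝ) (φ.symm y)
        (h.inner (φ.symm y) (coordVec φ y i) (coordVec φ y j))) φ.target :=
    ContMDiffOn.clm_bundle_apply₂ (F₁ := Rm m) (F₂ := Rm m)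
      ((h.contMDiff.of_le (by simp)).comp_contMDiffOn
        ((contMDiffOn_symm_of_mem_maximalAtlas hφ).of_le (by simp)))
      (contMDiffOn_coordVec hφ i) (contMDiffOn_coordVec hφ j)
  exact fun y hy =>
    ((Bundle.contMDiffWithinAt_totalSpace).1 (hentry y hy)).2.continuousWithinAt

end Charts

section Volume

theorem measurableSet_source_inter_preimage {X Y : Type*} [TopologicalSpace X]
    [TopologicalSpace Y] [MeasurableSpace X] [OpensMeasurableSpace X] [MeasurableSpace Y]
    [BorelSpace Y] (φ : OpenPartialHomeomorph X Y) {A : Set Y} (hA : MeasurableSet A) :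
    MeasurableSet (φ.source ∩ φ ⁻¹' A) := by
  have hφ : Measurable (φ.source.domRestrict φ) :=
    (continuousOn_iff_continuous_domRestrict.1 φ.continuousOn).measurable
  convert φ.open_source.measurableSet.subtype_image (hφ hA) using 1
  ext x
  simp [and_comm]

theorem lintegral_map_symm {X Y : Type*} [TopologicalSpace X] [TopologicalSpace Y]
    [MeasurableSpace X] [BorelSpace X] [MeasurableSpace Y] [BorelSpace Y]
    (φ : OpenPartialHomeomorph X Y) {ν : Measure Y} (hν : ∀ᵐ y ∂ν, y ∈ φ.target) (F : X → ℝ≥0∞) :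
    ∫⁻ x, F x ∂ν.map φ.symm = ∫⁻ y, F (φ.symm y) ∂ν := by
  have hφs : AEMeasurable φ.symm ν := by
    rw [← Measure.restrict_eq_self_of_ae_mem hν]
    exact φ.continuousOn_symm.aemeasurable φ.open_target.measurableSet
  have hsource : ∀ᵐ x ∂ν.map φ.symm, x ∈ φ.source :=
    (ae_map_iff (p := (· ∈ φ.source)) hφs φ.open_source.measurableSet).2
      (hν.mono fun y hy => φ.map_target hy)
  have hφ : AEMeasurable φ (ν.map φ.symm) := by
    rw [← Measure.restrict_eq_self_of_ae_mem hsource]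
    exact φ.continuousOn.aemeasurable φ.open_source.measurableSet
  have hback : (ν.map φ.symm).map φ = ν := by
    rw [AEMeasurable.map_map_of_aemeasurable hφ hφs,
      Measure.map_congr (hν.mono fun y hy => φ.right_inv hy : φ ∘ φ.symm =ᵐ[ν] id), Measure.map_id]
  refine le_antisymm (lintegral_map_le _ _) ?_
  calc ∫⁻ y, F (φ.symm y) ∂ν = ∫⁻ y, F (φ.symm y) ∂((ν.map φ.symm).map φ) := by rw [hback]
    _ ≤ ∫⁻ x, F (φ.symm (φ x)) ∂(ν.map φ.symm) := lintegral_map_le _ _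
    _ = ∫⁻ x, F x ∂(ν.map φ.symm) :=
        lintegral_congr_ae (hsource.mono fun x hx => by simp only [φ.left_inv hx])

variable {m : ℕ} {X : Type*} [TopologicalSpace X] [ChartedSpace (Rm m) X]
  [IsManifold (𝓡 m) ∞ X] {φ φ' : OpenPartialHomeomorph X (Rm m)}

theorem continuousOn_sqrt_det_gram (h : SmoothMetric m X)
    (hφ : φ ∈ IsManifold.maximalAtlas (𝓡 m) ∞ X) :
    ContinuousOn (fun y => √(gram h φ y).det) φ.target :=
  Real.continuous_sqrt.comp_continuousOn
    (continuous_id.matrix_det.comp_continuousOn (continuousOn_gram h hφ))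

/-- The density `√(det h)` of the Riemannian measure of `h` in the chart `φ`, with values in
`[0, ∞]` as a weight for the lower Lebesgue integral. -/
def volumeDensity (h : SmoothMetric m X) (φ : OpenPartialHomeomorph X (Rm m)) (y : Rm m) :
    ℝ≥0∞ :=
  ENNReal.ofReal √(gram h φ y).det

theorem aemeasurable_volumeDensity (h : SmoothMetric m X)
    (hφ : φ ∈ IsManifold.maximalAtlas (𝓡 m) ∞ X) :
    AEMeasurable (volumeDensity h φ) (volume.restrict φ.target) :=
  ((continuousOn_sqrt_det_gram h hφ).aemeasurable φ.open_target.measurableSet).ennreal_ofReal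

variable [MeasurableSpace X] [BorelSpace X]

theorem lintegral_chartVolume (h : SmoothMetric m X)
    (hφ : φ ∈ IsManifold.maximalAtlas (𝓡 m) ∞ X) (F : X → ℝ≥0∞) :
    ∫⁻ q, F q ∂chartVolume h φ = ∫⁻ y in φ.target, volumeDensity h φ y * F (φ.symm y) :=
  (lintegral_map_symm φ ((withDensity_absolutelyContinuous _ _)
    (ae_restrict_mem φ.open_target.measurableSet)) F).trans <|
      lintegral_withDensity_eq_lintegral_mul_non_measurable₀ _ (aemeasurable_volumeDensity h hφ)
        (Eventually.of_forall fun _ => ENNReal.ofReal_lt_top) _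

theorem setLIntegral_chartVolume (h : SmoothMetric m X)
    (hφ : φ ∈ IsManifold.maximalAtlas (𝓡 m) ∞ X) {A : Set X} (hA : MeasurableSet A)
    (F : X → ℝ≥0∞) :
    ∫⁻ q in A, F q ∂chartVolume h φ =
      ∫⁻ y in φ.target ∩ φ.symm ⁻¹' A, volumeDensity h φ y * F (φ.symm y) := by
  have hS : MeasurableSet (φ.target ∩ φ.symm ⁻¹' A) :=
    measurableSet_source_inter_preimage φ.symm hA
  rw [← lintegral_indicator hA, lintegral_chartVolume h hφ,
    ← inter_eq_left.2 (inter_subset_left (s := φ.target) (t := φ.symm ⁻¹' A)),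
    ← setLIntegral_indicator hS]
  refine setLIntegral_congr_fun φ.open_target.measurableSet fun y hy => ?_
  by_cases hyA : φ.symm y ∈ A <;> simp [hyA, hy]

theorem chartVolume_apply (h : SmoothMetric m X) (hφ : φ ∈ IsManifold.maximalAtlas (𝓡 m) ∞ X)
    {A : Set X} (hA : MeasurableSet A) :
    chartVolume h φ A = ∫⁻ y in φ.target ∩ φ.symm ⁻¹' A, volumeDensity h φ y := by
  simpa only [setLIntegral_one, mul_one] using setLIntegral_chartVolume h hφ hA fun _ => 1

theorem chartVolume_inter_source (h : SmoothMetric m X)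
    (hφ : φ ∈ IsManifold.maximalAtlas (𝓡 m) ∞ X) {A : Set X} (hA : MeasurableSet A) :
    chartVolume h φ (A ∩ φ.source) = chartVolume h φ A := by
  rw [chartVolume_apply h hφ hA, chartVolume_apply h hφ (hA.inter φ.open_source.measurableSet),
    preimage_inter, ← inter_assoc, inter_right_comm,
    inter_eq_left.2 (show φ.target ⊆ φ.symm ⁻¹' φ.source from φ.symm.mapsTo)]

theorem chartVolume_eq_of_subset (h : SmoothMetric m X)
    (hφ : φ ∈ IsManifold.maximalAtlas (𝓡 m) ∞ X) (hφ' : φ' ∈ IsManifold.maximalAtlas (𝓡 m) ∞ X)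
    {A : Set X} (hA : MeasurableSet A) (hs : A ⊆ φ.source) (hs' : A ⊆ φ'.source) :
    chartVolume h φ A = chartVolume h φ' A := by
  set S := φ.target ∩ φ.symm ⁻¹' A
  have hS : MeasurableSet S := measurableSet_source_inter_preimage φ.symm hA
  have himage : φ'.target ∩ φ'.symm ⁻¹' A = (φ' ∘ φ.symm) '' S := by
    rw [image_comp, ← φ'.image_eq_target_inter_inv_preimage hs']
    congr 1
    simp only [S]
    rw [← φ.image_eq_target_inter_inv_preimage hs]
    exact (φ.toPartialEquiv.symm_image_image_of_subset_source hs).symm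
  have hinj : InjOn (φ' ∘ φ.symm) S :=
    φ'.injOn.comp (φ.symm.injOn.mono inter_subset_left) fun y hy => hs' hy.2
  have hderiv : ∀ y ∈ S, HasFDerivWithinAt (φ' ∘ φ.symm) (fderiv ℝ (φ' ∘ φ.symm) y) S y :=
    fun y hy =>
      (differentiableAt_transition hφ hφ' hy.1 (hs' hy.2)).hasFDerivAt.hasFDerivWithinAt
  rw [chartVolume_apply h hφ hA, chartVolume_apply h hφ' hA, himage,
    lintegral_image_eq_lintegral_abs_det_fderiv_mul volume hS hderiv hinj]
  refine setLIntegral_congr_fun hS fun y hy => ?_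
  rw [volumeDensity, sqrt_det_gram_eq h hφ hφ' hy.1 (hs' hy.2), ENNReal.ofReal_mul (abs_nonneg _)]
  rfl

theorem restrict_riemVolume_source (h : SmoothMetric m X)
    (hφ : φ ∈ IsManifold.maximalAtlas (𝓡 m) ∞ X) :
    (riemVolume h).restrict φ.source = chartVolume h φ := by
  have hsource := φ.open_source.measurableSet
  refine le_antisymm ?_ ?_
  · have hle : riemVolume h ≤ chartVolume h φ + (⊤ : Measure X).restrict φ.sourceᶜ := by
      refine iSup₂_le fun ψ hψ => Measure.le_iff.2 fun S hS => ?_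
      have hSψ := hS.inter ψ.open_source.measurableSet
      calc chartVolume h ψ S = chartVolume h ψ (S ∩ ψ.source) :=
            (chartVolume_inter_source h hψ hS).symm
        _ = chartVolume h ψ (S ∩ ψ.source ∩ φ.source) +
              chartVolume h ψ ((S ∩ ψ.source) \ φ.source) :=
            (measure_inter_add_sdiff _ hsource).symm
        _ ≤ chartVolume h φ S + (⊤ : Measure X) (S ∩ φ.sourceᶜ) := by
            rw [chartVolume_eq_of_subset h hψ hφ (hSψ.inter hsource)
              (inter_subset_left.trans inter_subset_right) inter_subset_right]
            exact add_le_add (measure_mono (inter_subset_left.trans inter_subset_left))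
              ((measure_mono (inter_subset_inter_left _ inter_subset_left)).trans
                (Measure.le_iff'.1 le_top _))
        _ = (chartVolume h φ + (⊤ : Measure X).restrict φ.sourceᶜ) S := by
            rw [Measure.add_apply, Measure.restrict_apply hS]
    calc (riemVolume h).restrict φ.source
        ≤ (chartVolume h φ + (⊤ : Measure X).restrict φ.sourceᶜ).restrict φ.source :=
          Measure.restrict_mono_measure hle _
      _ = (chartVolume h φ).restrict φ.source := by
          rw [Measure.restrict_add, Measure.restrict_restrict hsource, inter_compl_self,
            Measure.restrict_empty, add_zero]
      _ ≤ chartVolume h φ := Measure.restrict_le_self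
  · refine Measure.le_iff.2 fun S hS => ?_
    rw [Measure.restrict_apply hS, ← chartVolume_inter_source h hφ hS]
    exact Measure.le_iff'.1 (le_iSup₂ (f := fun ψ (_ : ψ ∈ IsManifold.maximalAtlas (𝓡 m) ∞ X) =>
      chartVolume h ψ) φ hφ) _

theorem setLIntegral_riemVolume (h : SmoothMetric m X)
    (hφ : φ ∈ IsManifold.maximalAtlas (𝓡 m) ∞ X) {P : Set (Rm m)} (hP : MeasurableSet P)
    (F : X → ℝ≥0∞) :
    ∫⁻ q in φ.source ∩ φ ⁻¹' P, F q ∂riemVolume h =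
      ∫⁻ y in P ∩ φ.target, volumeDensity h φ y * F (φ.symm y) := by
  rw [← inter_eq_left.2 (inter_subset_left (s := φ.source) (t := φ ⁻¹' P)),
    ← Measure.restrict_restrict (measurableSet_source_inter_preimage φ hP),
    restrict_riemVolume_source h hφ,
    setLIntegral_chartVolume h hφ (measurableSet_source_inter_preimage φ hP)]
  congr 2
  ext y
  refine ⟨fun hy => ⟨?_, hy.1⟩, fun hy => ⟨hy.2, φ.map_target hy.2, ?_⟩⟩
  · simpa only [mem_preimage, φ.right_inv hy.1] using hy.2.2
  · simpa only [mem_preimage, φ.right_inv hy.2] using hy.1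

end Volume

section Compactness

theorem isCompact_closure_of_finiteDimensional_approx {E : Type*} [NormedAddCommGroup E]
    [NormedSpace ℝ E] [CompleteSpace E] {S : Set E} {R : ℝ} (hR : ∀ u ∈ S, ‖u‖ ≤ R)
    (h : ∀ η : ℝ, 0 < η → ∃ V : Submodule ℝ E, FiniteDimensional ℝ V ∧
      ∀ u ∈ S, ∃ v ∈ V, ‖u - v‖ ≤ η) : IsCompact (closure S) := by
  refine isCompact_iff_totallyBounded_isComplete.2
    ⟨TotallyBounded.closure ?_, isClosed_closure.isComplete⟩
  rw [Metric.totallyBounded_iff]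
  intro ε hε
  obtain ⟨V, hV, hVS⟩ := h (ε / 3) (by positivity)
  have : ProperSpace V := FiniteDimensional.proper ℝ V
  have hK : IsCompact ((↑) '' Metric.closedBall (0 : V) (R + ε / 3) : Set E) :=
    (isCompact_closedBall _ _).image continuous_subtype_val
  obtain ⟨t, ht, hcov⟩ := Metric.totallyBounded_iff.1 hK.totallyBounded (ε / 3) (by positivity)
  refine ⟨t, ht, fun u hu => ?_⟩
  obtain ⟨v, hv, huv⟩ := hVS u hu
  have hvK : v ∈ ((↑) '' Metric.closedBall (0 : V) (R + ε / 3) : Set E) := by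
    refine ⟨⟨v, hv⟩, ?_, rfl⟩
    rw [mem_closedBall_zero_iff]
    calc ‖v‖ = ‖u - (u - v)‖ := by congr 1; abel
      _ ≤ ‖u‖ + ‖u - v‖ := norm_sub_le _ _
      _ ≤ R + ε / 3 := add_le_add (hR u hu) huv
  obtain ⟨y, hy, hvy⟩ := mem_iUnion₂.1 (hcov hvK)
  refine mem_iUnion₂.2 ⟨y, hy, ?_⟩
  rw [Metric.mem_ball] at hvy ⊢
  calc dist u y ≤ dist u v + dist v y := dist_triangle _ _ _
    _ < ε := by rw [dist_eq_norm u v]; linarith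

variable {α : Type*} [MeasurableSpace α] {μ : Measure α}

theorem exists_disjoint_refinement {ι : Type*} [Finite ι] {A : ι → Set α}
    (hA : ∀ i, MeasurableSet (A i)) :
    ∃ A' : ι → Set α, (∀ i, MeasurableSet (A' i)) ∧ (∀ i, A' i ⊆ A i) ∧
      Pairwise (Function.onFun Disjoint A') ∧ ⋃ i, A' i = ⋃ i, A i := by
  set e := Finite.equivFin ι
  set B := disjointed (A ∘ e.symm)
  refine ⟨B ∘ e, fun i => ?_, fun i => ?_, ?_, ?_⟩
  · exact disjointedRec (p := MeasurableSet) (fun _ _ ht => ht.diff (hA _)) (hA _)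
  · simpa [B] using disjointed_subset (A ∘ e.symm) (e i)
  · exact (disjoint_disjointed _).comp_of_injective e.injective
  · calc ⋃ i, B (e i) = ⋃ k, B k := e.surjective.iUnion_comp B
      _ = ⋃ k, A (e.symm k) := iUnion_disjointed
      _ = ⋃ i, A i := e.symm.surjective.iUnion_comp A

theorem norm_le_of_lintegral_sq_le (f : Lp ℝ 2 μ) {η : ℝ} (hη : 0 ≤ η)
    (h : ∫⁻ x, ENNReal.ofReal (f x ^ 2) ∂μ ≤ ENNReal.ofReal (η ^ 2)) : ‖f‖ ≤ η := by
  have hsq : ∀ x, ‖f x‖ₑ ^ (2 : ℝ) = ENNReal.ofReal (f x ^ 2) := fun x => by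
    rw [← ofReal_norm, ENNReal.rpow_two, ← ENNReal.ofReal_pow (norm_nonneg _),
      Real.norm_eq_abs, sq_abs]
  rw [Lp.norm_def]
  refine ENNReal.toReal_le_of_le_ofReal hη ?_
  rw [eLpNorm_eq_lintegral_rpow_enorm_toReal two_ne_zero ENNReal.ofNat_ne_top,
    ENNReal.toReal_ofNat]
  simp_rw [hsq]
  calc _ ≤ ENNReal.ofReal (η ^ 2) ^ (1 / 2 : ℝ) := by gcongr
    _ = ENNReal.ofReal η := by
      rw [ENNReal.ofReal_pow hη, ← ENNReal.rpow_two, ← ENNReal.rpow_mul]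
      norm_num

theorem exists_finiteDimensional_stepFunctions [IsFiniteMeasure μ] {ι : Type*} [Finite ι]
    {A : ι → Set α} (hA : ∀ i, MeasurableSet (A i))
    (hdisj : Pairwise (Function.onFun Disjoint A)) :
    ∃ V : Submodule ℝ (Lp ℝ 2 μ), FiniteDimensional ℝ V ∧
      ∀ c : ι → ℝ, ∃ v ∈ V, ∀ᵐ x ∂μ, ∀ i, x ∈ A i → v x = c i := by
  have := Fintype.ofFinite ι
  set b : ι → Lp ℝ 2 μ := fun i => indicatorConstLp 2 (hA i) (measure_ne_top μ _) (1 : ℝ)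
  refine ⟨Submodule.span ℝ (range b), FiniteDimensional.span_of_finite ℝ (finite_range b),
    fun c => ⟨∑ i, c i • b i, Submodule.sum_mem _ fun i _ =>
      Submodule.smul_mem _ _ (Submodule.subset_span (mem_range_self i)), ?_⟩⟩
  have hb : ∀ i, ∀ᵐ x ∂μ, (c i • b i : Lp ℝ 2 μ) x = (A i).indicator (fun _ => c i) x := by
    intro i
    filter_upwards [Lp.coeFn_smul (c i) (b i),
      indicatorConstLp_coeFn (p := 2) (hs := hA i) (hμs := measure_ne_top μ _)
        (c := (1 : ℝ))] with x hx1 hx2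
    rw [hx1, Pi.smul_apply, hx2]
    by_cases hx : x ∈ A i <;> simp [hx]
  filter_upwards [Lp.coeFn_fun_finsetSum Finset.univ fun i => c i • b i,
    ae_all_iff.2 hb] with x hsum hx i hi
  rw [hsum, Finset.sum_congr rfl fun j _ => hx j, Finset.sum_eq_single_of_mem i
    (Finset.mem_univ i) fun j _ hji => indicator_of_notMem
      (fun hj => (hdisj hji).le_bot ⟨hj, hi⟩) _, indicator_of_mem hi]

theorem isCompact_closure_of_stepFunction_approx [IsFiniteMeasure μ] {S : Set (Lp ℝ 2 μ)} {R : ℝ}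
    (hR : ∀ u ∈ S, ‖u‖ ≤ R)
    (h : ∀ ε : ℝ≥0∞, ε ≠ 0 → ∃ (ι : Type*) (_ : Fintype ι) (A : ι → Set α),
      (∀ i, MeasurableSet (A i)) ∧ ⋃ i, A i = univ ∧ ∀ u ∈ S, ∃ c : ι → ℝ,
        ∑ i, ∫⁻ x in A i, ENNReal.ofReal ((u x - c i) ^ 2) ∂μ ≤ ε) :
    IsCompact (closure S) := by
  refine isCompact_closure_of_finiteDimensional_approx hR fun η hη => ?_
  obtain ⟨ι, _, A, hA, hcov, happrox⟩ := h (ENNReal.ofReal (η ^ 2))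
    (ENNReal.ofReal_pos.2 (by positivity)).ne'
  obtain ⟨A', hA', hsub, hdisj, hunion⟩ := exists_disjoint_refinement hA
  obtain ⟨V, hV, hstep⟩ := exists_finiteDimensional_stepFunctions (μ := μ) hA' hdisj
  refine ⟨V, hV, fun u hu => ?_⟩
  obtain ⟨c, hc⟩ := happrox u hu
  obtain ⟨v, hv, hvc⟩ := hstep c
  refine ⟨v, hv, norm_le_of_lintegral_sq_le _ hη.le ?_⟩
  calc ∫⁻ x, ENNReal.ofReal ((u - v : Lp ℝ 2 μ) x ^ 2) ∂μ
      = ∑ i, ∫⁻ x in A' i, ENNReal.ofReal ((u - v : Lp ℝ 2 μ) x ^ 2) ∂μ := by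
        rw [← setLIntegral_univ, ← hcov, ← hunion, lintegral_iUnion hA' hdisj, tsum_fintype]
    _ = ∑ i, ∫⁻ x in A' i, ENNReal.ofReal ((u x - c i) ^ 2) ∂μ := by
        refine Finset.sum_congr rfl fun i _ => setLIntegral_congr_fun_ae (hA' i) ?_
        filter_upwards [Lp.coeFn_sub u v, hvc] with x hsub hvc hx
        rw [hsub, Pi.sub_apply, hvc i hx]
    _ ≤ ∑ i, ∫⁻ x in A i, ENNReal.ofReal ((u x - c i) ^ 2) ∂μ :=
        Finset.sum_le_sum fun i _ => lintegral_mono_set (hsub i)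
    _ ≤ ENNReal.ofReal (η ^ 2) := hc

end Compactness

section LocalToGlobal

variable {m : ℕ} {X : Type*} [TopologicalSpace X] [ChartedSpace (Rm m) X]
  [IsManifold (𝓡 m) ∞ X] {h : SmoothMetric m X} {ψ : OpenPartialHomeomorph X (Rm m)}
  {y : Rm m} {r : ℝ}

/-- A chart `ψ` with a ball of radius `2 r` around `y`, on which the volume density has a high
enough integrability exponent and dominates the trace of the metric, and in which almost all
segments stay in the target of the chart. The part of the ball outside of the target, where `N`
lies, does not count. -/
structure IsAdmissibleBall (h : SmoothMetric m X) (ψ : OpenPartialHomeomorph X (Rm m)) (y : Rm m)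
    (r : ℝ) : Prop where
  mem_maximalAtlas : ψ ∈ IsManifold.maximalAtlas (𝓡 m) ∞ X
  radius_pos : 0 < r
  exists_exponent : ∃ q : ℝ, 1 < q ∧ m < 2 * q ∧
    ∫⁻ x in Metric.closedBall y (2 * r) ∩ ψ.target, volumeDensity h ψ x ^ q ≠ ⊤
  ae_segment : ∀ᵐ x, ∀ᵐ z, x ∈ Metric.closedBall y (2 * r) → z ∈ Metric.closedBall y (2 * r) →
    segment ℝ x z ⊆ ψ.target
  exists_trace_le : ∃ C : ℝ≥0, ∀ x ∈ Metric.closedBall y (2 * r) ∩ ψ.target,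
    ENNReal.ofReal (gram h ψ x).trace ≤ C * volumeDensity h ψ x

theorem gradSq_inner_coordVec_le (h : SmoothMetric m X) (ψ : OpenPartialHomeomorph X (Rm m))
    (Z : ∀ q : X, TangentSpace (𝓡 m) q) (y : Rm m) :
    gradSq (fun i y => h.inner (ψ.symm y) (Z (ψ.symm y)) (coordVec ψ y i)) y ≤
      ENNReal.ofReal (h.inner (ψ.symm y) (Z (ψ.symm y)) (Z (ψ.symm y))) *
        ENNReal.ofReal (gram h ψ y).trace := by
  rw [← ENNReal.ofReal_mul (inner_self_nonneg_of_smoothMetric h _), gradSq, Matrix.trace,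
    Finset.mul_sum]
  exact ENNReal.ofReal_le_ofReal (Finset.sum_le_sum fun i _ => sq_inner_coordVec_le h ψ y i _)

variable [MeasurableSpace X]

theorem exists_isWeakGradient_of_sobolevNorm_lt {u : X → ℝ} {C : ℝ≥0∞}
    (hu : sobolevNorm h u < C) : ∃ Z, IsWeakGradient h u Z ∧
      (∫⁻ q, ENNReal.ofReal (u q ^ 2) ∂riemVolume h) +
        ∫⁻ q, ENNReal.ofReal (h.inner q (Z q) (Z q)) ∂riemVolume h ≤ C ^ 2 := by
  simp only [sobolevNorm, iInf_lt_iff] at hu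
  obtain ⟨Z, hZ, hlt⟩ := hu
  refine ⟨Z, hZ, ?_⟩
  have hsq := ENNReal.rpow_le_rpow hlt.le zero_le_two
  rwa [← ENNReal.rpow_mul, one_div, inv_mul_cancel₀ two_ne_zero, ENNReal.rpow_one,
    ENNReal.rpow_two] at hsq

variable [BorelSpace X]

theorem lintegral_gradSq_le (hψ : ψ ∈ IsManifold.maximalAtlas (𝓡 m) ∞ X) {B : Set (Rm m)}
    (hB : MeasurableSet B) {C : ℝ≥0}
    (htr : ∀ x ∈ B ∩ ψ.target, ENNReal.ofReal (gram h ψ x).trace ≤ C * volumeDensity h ψ x)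
    (Z : ∀ q : X, TangentSpace (𝓡 m) q) :
    ∫⁻ y in B ∩ ψ.target,
        gradSq (fun i y => h.inner (ψ.symm y) (Z (ψ.symm y)) (coordVec ψ y i)) y ≤
      C * ∫⁻ q, ENNReal.ofReal (h.inner q (Z q) (Z q)) ∂riemVolume h := by
  calc ∫⁻ y in B ∩ ψ.target,
        gradSq (fun i y => h.inner (ψ.symm y) (Z (ψ.symm y)) (coordVec ψ y i)) y
      ≤ ∫⁻ y in B ∩ ψ.target, C * (volumeDensity h ψ y *
          ENNReal.ofReal (h.inner (ψ.symm y) (Z (ψ.symm y)) (Z (ψ.symm y)))) := by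
        refine setLIntegral_mono' (hB.inter ψ.open_target.measurableSet) fun y hy => ?_
        refine (gradSq_inner_coordVec_le h ψ Z y).trans ?_
        rw [← mul_assoc, mul_comm]
        gcongr
        exact htr y hy
    _ = C * ∫⁻ q in ψ.source ∩ ψ ⁻¹' B, ENNReal.ofReal (h.inner q (Z q) (Z q)) ∂riemVolume h := by
        rw [lintegral_const_mul' _ _ ENNReal.coe_ne_top, setLIntegral_riemVolume h hψ hB]
    _ ≤ C * ∫⁻ q, ENNReal.ofReal (h.inner q (Z q) (Z q)) ∂riemVolume h := by
        gcongr
        exact Measure.restrict_le_self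

namespace IsAdmissibleBall

theorem riemVolume_lt_top (hb : IsAdmissibleBall h ψ y r) :
    riemVolume h (ψ.source ∩ ψ ⁻¹' Metric.closedBall y r) < ⊤ := by
  obtain ⟨q, hq, -, hfin⟩ := hb.exists_exponent
  have hr : r ≤ 2 * r := by linarith [hb.radius_pos]
  have hpow : ∀ x : ℝ≥0∞, x ≤ 1 + x ^ q := fun x => by
    rcases le_total x 1 with hx | hx
    · exact hx.trans le_self_add
    · exact (ENNReal.le_rpow_self_of_one_le hx hq.le).trans le_add_self
  calc riemVolume h (ψ.source ∩ ψ ⁻¹' Metric.closedBall y r)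
      ≤ riemVolume h (ψ.source ∩ ψ ⁻¹' Metric.closedBall y (2 * r)) := by gcongr
    _ = ∫⁻ x in Metric.closedBall y (2 * r) ∩ ψ.target, volumeDensity h ψ x := by
        rw [← setLIntegral_one, setLIntegral_riemVolume h hb.mem_maximalAtlas
          Metric.isClosed_closedBall.measurableSet]
        simp only [mul_one]
    _ ≤ ∫⁻ x in Metric.closedBall y (2 * r) ∩ ψ.target, 1 + volumeDensity h ψ x ^ q :=
        lintegral_mono fun x => hpow _
    _ < ⊤ := by
        rw [lintegral_add_left measurable_const, setLIntegral_one]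
        exact ENNReal.add_lt_top.2 ⟨(measure_mono inter_subset_left).trans_lt
          (isCompact_closedBall y (2 * r)).measure_lt_top, hfin.lt_top⟩

theorem exists_finite_cover (hb : IsAdmissibleBall h ψ y r) (hm : 0 < m) {C : ℝ≥0∞}
    (hC : C ≠ ⊤) {ε : ℝ≥0∞} (hε : ε ≠ 0) :
    ∃ (T : Finset (Fin m → ℤ)) (A : (Fin m → ℤ) → Set X), (∀ k, MeasurableSet (A k)) ∧
      ψ.source ∩ ψ ⁻¹' Metric.closedBall y r ⊆ ⋃ k ∈ T, A k ∧
      ∀ {u : X → ℝ} {Z : ∀ q : X, TangentSpace (𝓡 m) q}, IsWeakGradient h u Z →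
        ∫⁻ q, ENNReal.ofReal (h.inner q (Z q) (Z q)) ∂riemVolume h ≤ C →
        ∃ c : (Fin m → ℤ) → ℝ,
          ∑ k ∈ T, ∫⁻ q in A k, ENNReal.ofReal ((u q - c k) ^ 2) ∂riemVolume h ≤ ε := by
  obtain ⟨q, hq, hmq, hfin⟩ := hb.exists_exponent
  obtain ⟨K, htr⟩ := hb.exists_trace_le
  have hψ := hb.mem_maximalAtlas
  have hη : ε / (K * C + 1) ≠ 0 := (ENNReal.div_pos hε (by finiteness)).ne'
  obtain ⟨T, P, hP, hcov, -, hpoincare⟩ := exists_finite_partition_lintegral_sq_sub_le hm hq hmq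
    ψ.open_target (aemeasurable_volumeDensity h hψ) hb.radius_pos hfin hb.ae_segment hη
  refine ⟨T, fun k => ψ.source ∩ ψ ⁻¹' P k,
    fun k => measurableSet_source_inter_preimage ψ (hP k), ?_, fun {u Z} hZ hZC => ?_⟩
  · simpa only [← inter_iUnion₂, ← preimage_iUnion₂] using
      inter_subset_inter_right ψ.source (preimage_mono hcov)
  obtain ⟨c, hc⟩ := hpoincare (hZ ψ hψ)
  refine ⟨c, ?_⟩
  simp only [setLIntegral_riemVolume h hψ (hP _), mul_comm (volumeDensity h ψ _)]
  calc ∑ k ∈ T, ∫⁻ x in P k ∩ ψ.target,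
        ENNReal.ofReal ((u (ψ.symm x) - c k) ^ 2) * volumeDensity h ψ x
      ≤ ε / (K * C + 1) * (K * ∫⁻ q, ENNReal.ofReal (h.inner q (Z q) (Z q)) ∂riemVolume h) :=
        hc.trans (mul_le_mul_right
          (lintegral_gradSq_le hψ Metric.isClosed_closedBall.measurableSet htr Z) _)
    _ ≤ ε / (K * C + 1) * (K * C + 1) := by
        gcongr
        exact (mul_le_mul_right hZC _).trans le_self_add
    _ = ε := ENNReal.div_mul_cancel (by simp) (by finiteness)

end IsAdmissibleBall

theorem sobolevCompactlyIncluded_of_admissibleBalls (hm : 0 < m) {ι : Type*} [Finite ι]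
    {ψ : ι → OpenPartialHomeomorph X (Rm m)} {y : ι → Rm m} {r : ι → ℝ}
    (hb : ∀ j, IsAdmissibleBall h (ψ j) (y j) (r j))
    (hcov : ⋃ j, (ψ j).source ∩ ψ j ⁻¹' Metric.closedBall (y j) (r j) = univ) :
    SobolevCompactlyIncluded h := by
  have := Fintype.ofFinite ι
  rintro S - ⟨C, hC⟩
  have hlt : ∀ u ∈ S, sobolevNorm h u < (C + 1 : ℝ≥0) := fun u hu =>
    (hC u hu).trans_lt (by exact_mod_cast lt_add_one C)
  have : IsFiniteMeasure (riemVolume h) := ⟨by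
    rw [← hcov]
    exact (measure_iUnion_fintype_le _ _).trans_lt
      (ENNReal.sum_lt_top.2 fun j _ => (hb j).riemVolume_lt_top)⟩
  refine isCompact_closure_of_stepFunction_approx (R := (C + 1 : ℝ≥0)) (fun u hu => ?_)
    fun ε hε => ?_
  · obtain ⟨Z, -, hZ⟩ := exists_isWeakGradient_of_sobolevNorm_lt (hlt u hu)
    refine norm_le_of_lintegral_sq_le u NNReal.zero_le_coe (le_self_add.trans (hZ.trans_eq ?_))
    rw [ENNReal.ofReal_pow NNReal.zero_le_coe, ENNReal.ofReal_coe_nnreal]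
  have hει : ε / Fintype.card ι ≠ 0 := (ENNReal.div_pos hε (ENNReal.natCast_ne_top _)).ne'
  choose T A hA hsub happrox using fun j =>
    (hb j).exists_finite_cover hm (C := ((C + 1 : ℝ≥0) : ℝ≥0∞) ^ 2) (by finiteness) hει
  refine ⟨Σ j, T j, inferInstance, fun i => A i.1 i.2, fun i => hA i.1 i.2, ?_, fun u hu => ?_⟩
  · refine univ_subset_iff.1 (hcov ▸ iUnion_subset fun j => (hsub j).trans ?_)
    exact iUnion₂_subset fun k hk =>
      subset_iUnion (fun i : Σ j, T j => A i.1 i.2) ⟨j, k, hk⟩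
  · obtain ⟨Z, hZ, hZC⟩ := exists_isWeakGradient_of_sobolevNorm_lt (hlt u hu)
    choose c hc using fun j => happrox j hZ (le_add_self.trans hZC)
    refine ⟨fun i => c i.1 i.2, ?_⟩
    calc ∑ i : Σ j, T j, ∫⁻ q in A i.1 i.2, ENNReal.ofReal ((u q - c i.1 i.2) ^ 2) ∂riemVolume h
        = ∑ j, ∑ k ∈ T j, ∫⁻ q in A j k, ENNReal.ofReal ((u q - c j k) ^ 2) ∂riemVolume h := by
          rw [Fintype.sum_sigma]
          exact Finset.sum_congr rfl fun j _ => Finset.sum_coe_sort (T j) fun k =>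
            ∫⁻ q in A j k, ENNReal.ofReal ((u q - c j k) ^ 2) ∂riemVolume h
      _ ≤ ∑ _j : ι, ε / Fintype.card ι := Finset.sum_le_sum fun j _ => hc j
      _ = Fintype.card ι * (ε / Fintype.card ι) := by
          rw [Finset.sum_const, nsmul_eq_mul, Finset.card_univ]
      _ ≤ ε := ENNReal.mul_div_le

end LocalToGlobal

section OpenSubmanifold

variable {X H : Type*} [TopologicalSpace X] [TopologicalSpace H] {s : TopologicalSpace.Opens X}
  {φ : OpenPartialHomeomorph X H}

theorem subtypeRestr_mem_maximalAtlas_of_mem_maximalAtlas [ChartedSpace H X]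
    {G : StructureGroupoid H} [HasGroupoid X G] [ClosedUnderRestriction G] (hs : Nonempty s)
    (hφ : φ ∈ G.maximalAtlas X) : φ.subtypeRestr hs ∈ G.maximalAtlas s := by
  intro e' he'
  obtain ⟨x, rfl⟩ := TopologicalSpace.Opens.chart_eq hs he'
  have hx : chartAt H (x : X) ∈ G.maximalAtlas X := G.chart_mem_maximalAtlas (x : X)
  have hcompatible : ∀ {e e' : OpenPartialHomeomorph X H}, e ∈ G.maximalAtlas X →
      e' ∈ G.maximalAtlas X → (e.subtypeRestr hs).symm ≫ₕ e'.subtypeRestr hs ∈ G :=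
    fun {e e'} he he' =>
      G.mem_of_eqOnSource (closedUnderRestriction' (G.compatible_of_mem_maximalAtlas he he')
        (e.isOpen_inter_preimage_symm s.2)) (e.subtypeRestr_symm_trans_subtypeRestr hs e')
  exact ⟨hcompatible hφ hx, hcompatible hx hφ⟩

theorem mem_subtypeRestr_target_iff (hs : Nonempty s) {y : H} :
    y ∈ (φ.subtypeRestr hs).target ↔ y ∈ φ.target ∧ φ.symm y ∈ s := by
  refine ⟨fun hy => ⟨φ.subtypeRestr_target_subset hs hy, ?_⟩, fun ⟨hy, hys⟩ => ?_⟩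
  · rw [← φ.subtypeRestr_symm_apply hs hy]
    exact Subtype.coe_prop _
  · simpa only [φ.right_inv hy] using
      φ.map_subtype_source hs (x := ⟨φ.symm y, hys⟩) (φ.map_target hy)

end OpenSubmanifold

section CompactBalls

variable {m : ℕ} {X : Type*} [TopologicalSpace X] [ChartedSpace (Rm m) X]
  [IsManifold (𝓡 m) ∞ X] {φ : OpenPartialHomeomorph X (Rm m)} {K : Set (Rm m)}

theorem exists_volumeDensity_le (h : SmoothMetric m X)
    (hφ : φ ∈ IsManifold.maximalAtlas (𝓡 m) ∞ X) (hK : IsCompact K) (hKφ : K ⊆ φ.target) :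
    ∃ C : ℝ≥0, ∀ y ∈ K, volumeDensity h φ y ≤ C := by
  obtain ⟨C, hC⟩ := hK.exists_bound_of_continuousOn ((continuousOn_sqrt_det_gram h hφ).mono hKφ)
  exact ⟨C.toNNReal, fun y hy => ENNReal.ofReal_le_ofReal ((le_abs_self _).trans (hC y hy))⟩

theorem exists_trace_gram_le (h : SmoothMetric m X)
    (hφ : φ ∈ IsManifold.maximalAtlas (𝓡 m) ∞ X) (hK : IsCompact K) (hKφ : K ⊆ φ.target) :
    ∃ C : ℝ≥0, ∀ y ∈ K, ENNReal.ofReal (gram h φ y).trace ≤ C * volumeDensity h φ y := by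
  have hpos : ∀ y ∈ K, 0 < √(gram h φ y).det := fun y hy =>
    Real.sqrt_pos.2 (gram_posDef h hφ (hKφ hy)).det_pos
  have hquot : ContinuousOn (fun y => (gram h φ y).trace / √(gram h φ y).det) K :=
    ((continuous_id.matrix_trace.comp_continuousOn (continuousOn_gram h hφ)).mono hKφ).div
      ((continuousOn_sqrt_det_gram h hφ).mono hKφ) fun y hy => (hpos y hy).ne'
  obtain ⟨C, hC⟩ := hK.exists_bound_of_continuousOn hquot
  refine ⟨C.toNNReal, fun y hy => ?_⟩
  rw [volumeDensity, ← ENNReal.ofReal_coe_nnreal, ← ENNReal.ofReal_mul C.toNNReal.coe_nonneg]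
  exact ENNReal.ofReal_le_ofReal ((div_le_iff₀ (hpos y hy)).1
    (((le_abs_self _).trans (hC y hy)).trans (Real.le_coe_toNNReal C)))

theorem isAdmissibleBall_of_closedBall_subset (hm : 2 ≤ m) (h : SmoothMetric m X)
    (hφ : φ ∈ IsManifold.maximalAtlas (𝓡 m) ∞ X) {y : Rm m} {r : ℝ} (hr : 0 < r)
    (hB : Metric.closedBall y (2 * r) ⊆ φ.target) : IsAdmissibleBall h φ y r where
  mem_maximalAtlas := hφ
  radius_pos := hr
  exists_exponent := by
    have hK := isCompact_closedBall y (2 * r)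
    have hm' : (2 : ℝ) ≤ m := by exact_mod_cast hm
    obtain ⟨C, hC⟩ := exists_volumeDensity_le h hφ hK hB
    refine ⟨m, by linarith, by linarith, (setLIntegral_lt_top_of_le_nnreal
      ((measure_mono inter_subset_left).trans_lt hK.measure_lt_top).ne
      ⟨C ^ (m : ℝ), fun x hx => ?_⟩).ne⟩
    rw [ENNReal.coe_rpow_of_nonneg _ m.cast_nonneg]
    exact ENNReal.rpow_le_rpow (hC x hx.1) m.cast_nonneg
  ae_segment := Eventually.of_forall fun _ => Eventually.of_forall fun _ hx hz =>
    ((convex_closedBall y (2 * r)).segment_subset hx hz).trans hB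
  exists_trace_le := by
    obtain ⟨C, hC⟩ := exists_trace_gram_le h hφ (isCompact_closedBall y (2 * r)) hB
    exact ⟨C, fun x hx => hC x hx.1⟩

end CompactBalls

section Covering

theorem exists_pos_closedBall_two_mul_subset {E : Type*} [PseudoMetricSpace E] {s : Set E} {y : E}
    (hs : s ∈ 𝓝 y) : ∃ r : ℝ, 0 < r ∧ Metric.closedBall y (2 * r) ⊆ s := by
  obtain ⟨ε, hε, hsub⟩ := Metric.nhds_basis_closedBall.mem_iff.1 hs
  exact ⟨ε / 2, by positivity, by rwa [mul_div_cancel₀ _ two_ne_zero]⟩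

variable {m : ℕ} {M : Type*} [TopologicalSpace M] [ChartedSpace (Rm m) M] [IsManifold (𝓡 m) ∞ M]
  {s : TopologicalSpace.Opens M} {hs : Nonempty s} {h : SmoothMetric m s}

theorem exists_isAdmissibleBall_chartAt (hm : 2 ≤ m) (h : SmoothMetric m s) {p : M} (hp : p ∈ s) :
    ∃ r, IsAdmissibleBall h ((chartAt (Rm m) p).subtypeRestr hs) (chartAt (Rm m) p p) r := by
  set φ := chartAt (Rm m) p
  have hpφ : p ∈ φ.source := mem_chart_source _ p
  have hpt : φ p ∈ (φ.subtypeRestr hs).target :=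
    (mem_subtypeRestr_target_iff hs).2 ⟨φ.map_source hpφ, by rwa [φ.left_inv hpφ]⟩
  obtain ⟨r, hr, hsub⟩ := exists_pos_closedBall_two_mul_subset
    ((φ.subtypeRestr hs).open_target.mem_nhds hpt)
  exact ⟨r, isAdmissibleBall_of_closedBall_subset hm h
    (subtypeRestr_mem_maximalAtlas_of_mem_maximalAtlas hs
      (IsManifold.chart_mem_maximalAtlas p)) hr hsub⟩

theorem sobolevCompactlyIncluded_of_forall_exists_isAdmissibleBall [CompactSpace M]
    [MeasurableSpace M] [BorelSpace M] (hm : 0 < m)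
    (hloc : ∀ p : M, ∃ φ : OpenPartialHomeomorph M (Rm m), p ∈ φ.source ∧
      ∃ r, IsAdmissibleBall h (φ.subtypeRestr hs) (φ p) r) :
    SobolevCompactlyIncluded h := by
  choose φ hp r hb using hloc
  obtain ⟨T, -, hT⟩ := isCompact_univ.elim_nhds_subcover
    (fun p => (φ p).source ∩ φ p ⁻¹' Metric.closedBall (φ p p) (r p)) fun p _ =>
      inter_mem ((φ p).open_source.mem_nhds (hp p)) (((φ p).continuousAt (hp p)).preimage_mem_nhds
        (Metric.closedBall_mem_nhds _ (hb p).radius_pos))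
  refine sobolevCompactlyIncluded_of_admissibleBalls hm (ι := T) (fun p => hb p)
    (eq_univ_of_forall fun x => ?_)
  obtain ⟨p, hpT, hxs, hxB⟩ := mem_iUnion₂.1 (hT (mem_univ (x : M)))
  exact mem_iUnion.2 ⟨⟨p, hpT⟩, by rwa [(φ p).subtypeRestr_source], hxB⟩

end Covering

section BlockScaling

variable {m n : ℕ}

/-- The factors by which the coordinate vectors are rescaled: `a` in the `x`-directions, `1` in the
`y`-directions. -/
def blockScale (m n : ℕ) (a : ℝ) (i : Fin m) : ℝ := if (i : ℕ) < m - n then a else 1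

theorem prod_blockScale (m n : ℕ) (a : ℝ) : ∏ i : Fin m, blockScale m n a i = a ^ (m - n) := by
  simp only [blockScale, Finset.prod_ite, Finset.prod_const, one_pow, mul_one,
    Fin.card_filter_val_lt, min_eq_right (Nat.sub_le m n)]

theorem blockScale_sq_le_of_le_abs (hmn : n + 2 ≤ m) {a c : ℝ} (hc : 0 < c) (hac : c ≤ |a|)
    (i : Fin m) :
    blockScale m n a i ^ 2 ≤ ((c ^ (m - n - 2))⁻¹ + (c ^ (m - n))⁻¹) * |a| ^ (m - n) := by
  have ha : 0 < |a| := hc.trans_le hac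
  have hx : a ^ 2 ≤ (c ^ (m - n - 2))⁻¹ * |a| ^ (m - n) := by
    rw [inv_mul_eq_div, le_div_iff₀ (by positivity), mul_comm, ← sq_abs]
    calc c ^ (m - n - 2) * |a| ^ 2 ≤ |a| ^ (m - n - 2) * |a| ^ 2 := by gcongr
      _ = |a| ^ (m - n) := by rw [← pow_add]; congr 1; omega
  have hy : 1 ≤ (c ^ (m - n))⁻¹ * |a| ^ (m - n) := by
    rw [inv_mul_eq_div, le_div_iff₀ (by positivity), one_mul]
    gcongr
  rw [add_mul, blockScale]
  split_ifs
  · exact le_add_of_le_of_nonneg hx (by positivity)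
  · rw [one_pow]
    exact le_add_of_nonneg_of_le (by positivity) hy

theorem exists_blockScale_sq_le (hmn : n + 2 ≤ m) {s : Set ℝ}
    (hs : 3 ≤ m → ∃ c : ℝ, 0 < c ∧ ∀ a ∈ s, c ≤ |a|) :
    ∃ C : ℝ≥0, ∀ a ∈ s, ∀ i : Fin m, blockScale m n a i ^ 2 ≤ C * |a| ^ (m - n) := by
  rcases (show 2 ≤ m by omega).eq_or_lt with hm | hm
  · refine ⟨1, fun a _ i => ?_⟩
    rw [blockScale, if_pos (by omega), show m - n = 2 by omega, sq_abs, NNReal.coe_one, one_mul]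
  · obtain ⟨c, hc, hcs⟩ := hs hm
    lift c to ℝ≥0 using hc.le
    exact ⟨(c ^ (m - n - 2))⁻¹ + (c ^ (m - n))⁻¹, fun a ha i => by
      simpa using blockScale_sq_le_of_le_abs hmn hc (hcs a ha) i⟩

theorem sqrt_det_diagonal_mul_mul_diagonal (D : Fin m → ℝ) (G : Matrix (Fin m) (Fin m) ℝ) :
    √(Matrix.diagonal D * G * Matrix.diagonal D).det = |∏ i, D i| * √G.det := by
  rw [Matrix.det_mul, Matrix.det_mul, Matrix.det_diagonal, mul_right_comm, ← sq,
    Real.sqrt_mul (sq_nonneg _), Real.sqrt_sq_eq_abs]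

theorem trace_diagonal_mul_mul_diagonal_le {D : Fin m → ℝ} {G : Matrix (Fin m) (Fin m) ℝ}
    (hG : G.PosSemidef) {C : ℝ} (hD : ∀ i, D i ^ 2 ≤ C) :
    (Matrix.diagonal D * G * Matrix.diagonal D).trace ≤ C * G.trace := by
  rw [Matrix.trace, Matrix.trace, Finset.mul_sum]
  refine Finset.sum_le_sum fun i _ => ?_
  calc (Matrix.diagonal D * G * Matrix.diagonal D) i i = D i ^ 2 * G i i := by
        rw [Matrix.mul_diagonal, Matrix.diagonal_mul]; ring
    _ ≤ C * G i i := mul_le_mul_of_nonneg_right (hD i) hG.diag_nonneg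

variable {X X' : Type*} [TopologicalSpace X] [ChartedSpace (Rm m) X]
  [TopologicalSpace X'] [ChartedSpace (Rm m) X']
  {φ : OpenPartialHomeomorph X (Rm m)} {ψ : OpenPartialHomeomorph X' (Rm m)}

theorem dcoord_coordVec (hφ : φ ∈ IsManifold.maximalAtlas (𝓡 m) ∞ X) {y : Rm m}
    (hy : y ∈ φ.target) (k i : Fin m) :
    dcoord φ k (φ.symm y) (coordVec φ y i) = if k = i then 1 else 0 := by
  have hid := congrArg (fun L : Rm m →L[ℝ] Rm m => L (EuclideanSpace.single i 1) k)
    ((mdifferentiable_of_mem_maximalAtlas hφ).comp_symm_deriv hy)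
  have hcoord : dcoord φ k (φ.symm y) (coordVec φ y i) =
      (EuclideanSpace.single i (1 : ℝ) : Rm m) k := hid
  rw [hcoord, PiLp.single_apply]

theorem blockForm_smul_coordVec (hnm : n ≤ m)
    (hφ : φ ∈ IsManifold.maximalAtlas (𝓡 m) ∞ X) (hψ : ψ ∈ IsManifold.maximalAtlas (𝓡 m) ∞ X')
    {y : Rm m} (hy : y ∈ φ.target) (hy' : y ∈ ψ.target) (a : ℝ)
    (A : Matrix (Fin (m - n)) (Fin (m - n)) ℝ) (B : Matrix (Fin n) (Fin n) ℝ) (i j : Fin m) :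
    blockForm hnm ψ (a ^ 2 • A) B (ψ.symm y) (coordVec ψ y i) (coordVec ψ y j) =
      blockScale m n a i * blockForm hnm φ A B (φ.symm y) (coordVec φ y i) (coordVec φ y j) *
        blockScale m n a j := by
  have hxIdx : ∀ k, blockScale m n a (xIdx m n k) = a := fun k => by simp [blockScale, xIdx]
  have hyIdx : ∀ k, blockScale m n a (yIdx hnm k) = 1 := fun k => by simp [blockScale, yIdx]
  simp only [blockForm, dcoord_coordVec hφ hy, dcoord_coordVec hψ hy', mul_add, add_mul,
    Finset.mul_sum, Finset.sum_mul]
  congr 1 <;> refine Finset.sum_congr rfl fun k _ => Finset.sum_congr rfl fun l _ => ?_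
  · rcases eq_or_ne (xIdx m n k) i with rfl | hk
    · rcases eq_or_ne (xIdx m n l) j with rfl | hl
      · simp only [Matrix.smul_apply, smul_eq_mul, hxIdx, if_true]
        ring
      · simp [hl]
    · simp [hk]
  · rcases eq_or_ne (yIdx hnm k) i with rfl | hk
    · rcases eq_or_ne (yIdx hnm l) j with rfl | hl
      · simp [hyIdx]
      · simp [hl]
    · simp [hk]

end BlockScaling

section AlmostEverySegment

theorem ae_linearMap_ne_zero {E : Type*} [NormedAddCommGroup E] [NormedSpace ℝ E]
    [FiniteDimensional ℝ E] [MeasurableSpace E] [BorelSpace E] (μ : Measure E)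
    [μ.IsAddHaarMeasure] {L : E →ₗ[ℝ] ℝ} (hL : L ≠ 0) : ∀ᵐ x ∂μ, L x ≠ 0 := by
  refine compl_mem_ae_iff.2 (measure_mono_null ?_
    (μ.addHaar_submodule L.ker fun hker => hL (LinearMap.ker_eq_top.1 hker)))
  exact fun x hx => hx

variable {m n : ℕ}

theorem ae_ae_segment_ne_zero {i j : Fin m} (hij : i ≠ j) :
    ∀ᵐ x : Rm m, ∀ᵐ z : Rm m, ∀ w ∈ segment ℝ x z, w i ≠ 0 ∨ w j ≠ 0 := by
  let coord (k : Fin m) : Rm m →ₗ[ℝ] ℝ := (EuclideanSpace.proj k : Rm m →L[ℝ] ℝ).toLinearMap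
  have hcoord : coord i ≠ 0 := fun h => by
    simpa [coord] using LinearMap.congr_fun h (EuclideanSpace.single i 1)
  filter_upwards [ae_linearMap_ne_zero volume hcoord] with x (hx : x i ≠ 0)
  have hminor : x i • coord j - x j • coord i ≠ 0 := fun h => by
    simpa [coord, hij, hx] using LinearMap.congr_fun h (EuclideanSpace.single j 1)
  filter_upwards [ae_linearMap_ne_zero volume hminor] with z (hz : x i * z j - x j * z i ≠ 0)
  rintro w ⟨a, b, -, -, hab, rfl⟩
  by_contra! hw
  obtain ⟨hwi : a * x i + b * z i = 0, hwj : a * x j + b * z j = 0⟩ := hw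
  have hb : b = 0 := (mul_eq_zero.1 (show b * (x i * z j - x j * z i) = 0 by
    linear_combination x i * hwj - x j * hwi)).resolve_right hz
  have ha : a = 1 := by rwa [hb, add_zero] at hab
  exact hx (by simpa [ha, hb] using hwi)

theorem IsSliceChart.ae_ae_segment_notMem {M : Type*} [TopologicalSpace M] [ChartedSpace (Rm m) M]
    {N : Set M} {φ : OpenPartialHomeomorph M (Rm m)} (hφ : IsSliceChart n N φ) (hmn : n + 2 ≤ m) :
    ∀ᵐ x, ∀ᵐ z, ∀ w ∈ segment ℝ x z, w ∈ φ.target → φ.symm w ∉ N := by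
  have hij : xIdx m n ⟨0, by omega⟩ ≠ xIdx m n ⟨1, by omega⟩ := by simp [xIdx, Fin.ext_iff]
  filter_upwards [ae_ae_segment_ne_zero hij] with x hx
  filter_upwards [hx] with z hz w hw hwφ hwN
  have hzero : ∀ i : Fin (m - n), w (xIdx m n i) = 0 := by
    simpa only [φ.right_inv hwφ] using (hφ.2 _ (φ.map_target hwφ)).1 hwN
  exact (hz w hw).elim (absurd (hzero _)) (absurd (hzero _))

end AlmostEverySegment

section BlockScaledMetric

variable {m n : ℕ} {M : Type*} [TopologicalSpace M] [ChartedSpace (Rm m) M]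
  [IsManifold (𝓡 m) ∞ M] {s : TopologicalSpace.Opens M} {hs : Nonempty s} {g : SmoothMetric m M}
  {g' : SmoothMetric m s} {f : M → ℝ} {φ : OpenPartialHomeomorph M (Rm m)}

/-- In the coordinates `(x, y)` of the chart `φ`, the metric `g'` on the open submanifold `s`
arises from `g` by multiplying the `x`-block by `f ^ 2` (and the mixed blocks by `f`). -/
def HasBlockScaledGram (n : ℕ) (hs : Nonempty s) (g : SmoothMetric m M) (g' : SmoothMetric m s)
    (f : M → ℝ) (φ : OpenPartialHomeomorph M (Rm m)) : Prop :=
  ∀ x ∈ (φ.subtypeRestr hs).target, gram g' (φ.subtypeRestr hs) x =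
    Matrix.diagonal (blockScale m n (f (φ.symm x))) * gram g φ x *
      Matrix.diagonal (blockScale m n (f (φ.symm x)))

theorem hasBlockScaledGram_of_inner_eq_blockForm (hnm : n ≤ m)
    (hφ : φ ∈ IsManifold.maximalAtlas (𝓡 m) ∞ M)
    {g₁ : M → Matrix (Fin (m - n)) (Fin (m - n)) ℝ} {g₂ : M → Matrix (Fin n) (Fin n) ℝ}
    (hg : ∀ q ∈ φ.source, ∀ v w : TangentSpace (𝓡 m) q,
      g.inner q v w = blockForm hnm φ (g₁ q) (g₂ q) q v w)
    (hg' : ∀ q : s, (q : M) ∈ φ.source → ∀ v w : TangentSpace (𝓡 m) q,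
      g'.inner q v w = blockForm hnm (fun x : s => φ x) (f q ^ 2 • g₁ q) (g₂ q) q v w) :
    HasBlockScaledGram n hs g g' f φ := by
  intro x hx
  have hxφ := φ.subtypeRestr_target_subset hs hx
  have hsymm : (((φ.subtypeRestr hs).symm x : s) : M) = φ.symm x :=
    φ.subtypeRestr_symm_apply hs hx
  ext i j
  rw [Matrix.mul_diagonal, Matrix.diagonal_mul]
  have hij := hg' ((φ.subtypeRestr hs).symm x) (by rw [hsymm]; exact φ.map_target hxφ)
    (coordVec _ x i) (coordVec _ x j)
  rw [hsymm] at hij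
  refine hij.trans ((blockForm_smul_coordVec hnm hφ
    (subtypeRestr_mem_maximalAtlas_of_mem_maximalAtlas hs hφ) hxφ hx _ _ _ i j).trans ?_)
  rw [← hg _ (φ.map_target hxφ)]
  rfl

namespace HasBlockScaledGram

theorem volumeDensity_eq (hgram : HasBlockScaledGram n hs g g' f φ) {x : Rm m}
    (hx : x ∈ (φ.subtypeRestr hs).target) :
    volumeDensity g' (φ.subtypeRestr hs) x =
      ENNReal.ofReal (|f (φ.symm x)| ^ (m - n)) * volumeDensity g φ x := by
  rw [volumeDensity, hgram x hx, sqrt_det_diagonal_mul_mul_diagonal, prod_blockScale, abs_pow,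
    ENNReal.ofReal_mul (by positivity), volumeDensity]

theorem exists_trace_le (hgram : HasBlockScaledGram n hs g g' f φ)
    (hφ : φ ∈ IsManifold.maximalAtlas (𝓡 m) ∞ M) {C : ℝ≥0}
    (hC : ∀ p ∈ s, ∀ i : Fin m, blockScale m n (f p) i ^ 2 ≤ C * |f p| ^ (m - n))
    {K : Set (Rm m)} (hK : IsCompact K) (hKφ : K ⊆ φ.target) :
    ∃ C' : ℝ≥0, ∀ x ∈ K ∩ (φ.subtypeRestr hs).target,
      ENNReal.ofReal (gram g' (φ.subtypeRestr hs) x).trace ≤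
        C' * volumeDensity g' (φ.subtypeRestr hs) x := by
  obtain ⟨C', hC'⟩ := exists_trace_gram_le g hφ hK hKφ
  refine ⟨C * C', fun x ⟨hxK, hx⟩ => ?_⟩
  have hxs := ((mem_subtypeRestr_target_iff hs).1 hx).2
  calc ENNReal.ofReal (gram g' (φ.subtypeRestr hs) x).trace
      ≤ ENNReal.ofReal (C * |f (φ.symm x)| ^ (m - n) * (gram g φ x).trace) := by
        rw [hgram x hx]
        exact ENNReal.ofReal_le_ofReal (trace_diagonal_mul_mul_diagonal_le
          (gram_posDef g hφ (hKφ hxK)).posSemidef (hC _ hxs))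
    _ = C * ENNReal.ofReal (|f (φ.symm x)| ^ (m - n)) * ENNReal.ofReal (gram g φ x).trace := by
        rw [ENNReal.ofReal_mul (by positivity), ENNReal.ofReal_mul C.coe_nonneg,
          ENNReal.ofReal_coe_nnreal]
    _ ≤ C * ENNReal.ofReal (|f (φ.symm x)| ^ (m - n)) * (C' * volumeDensity g φ x) := by
        gcongr
        exact hC' x hxK
    _ = (C * C' : ℝ≥0) * volumeDensity g' (φ.subtypeRestr hs) x := by
        rw [hgram.volumeDensity_eq hx, ENNReal.coe_mul]
        ring

variable [MeasurableSpace M] [BorelSpace M]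

theorem lintegral_volumeDensity_rpow_ne_top (hgram : HasBlockScaledGram n hs g g' f φ)
    (hφ : φ ∈ IsManifold.maximalAtlas (𝓡 m) ∞ M) {q : ℝ} (hq : 1 ≤ q)
    (hf : ∫⁻ p, ENNReal.ofReal (|f p| ^ (m - n)) ^ q ∂riemVolume g ≠ ⊤)
    {K : Set (Rm m)} (hK : IsCompact K) (hKφ : K ⊆ φ.target) :
    ∫⁻ x in K ∩ (φ.subtypeRestr hs).target, volumeDensity g' (φ.subtypeRestr hs) x ^ q ≠ ⊤ := by
  obtain ⟨C, hC⟩ := exists_volumeDensity_le g hφ hK hKφ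
  have hbound : ∀ x ∈ K ∩ (φ.subtypeRestr hs).target,
      volumeDensity g' (φ.subtypeRestr hs) x ^ q ≤ C ^ (q - 1) * (volumeDensity g φ x *
        ENNReal.ofReal (|f (φ.symm x)| ^ (m - n)) ^ q) := fun x ⟨hxK, hx⟩ => by
    rw [hgram.volumeDensity_eq hx, ENNReal.mul_rpow_of_nonneg _ _ (by linarith), mul_comm,
      ← mul_assoc]
    gcongr
    calc volumeDensity g φ x ^ q = volumeDensity g φ x ^ (q - 1) * volumeDensity g φ x := by
          simpa only [sub_add_cancel, ENNReal.rpow_one] using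
            ENNReal.rpow_add_of_nonneg (x := volumeDensity g φ x) (q - 1) 1 (by linarith)
              zero_le_one
      _ ≤ C ^ (q - 1) * volumeDensity g φ x := by
          gcongr
          exact hC x hxK
  have hCtop : (C : ℝ≥0∞) ^ (q - 1) ≠ ⊤ :=
    ENNReal.rpow_ne_top_of_nonneg (by linarith) ENNReal.coe_ne_top
  refine ne_top_of_le_ne_top (ENNReal.mul_ne_top hCtop hf) ?_
  calc ∫⁻ x in K ∩ (φ.subtypeRestr hs).target, volumeDensity g' (φ.subtypeRestr hs) x ^ q
      ≤ ∫⁻ x in K ∩ (φ.subtypeRestr hs).target, C ^ (q - 1) * (volumeDensity g φ x *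
          ENNReal.ofReal (|f (φ.symm x)| ^ (m - n)) ^ q) :=
        setLIntegral_mono' (hK.measurableSet.inter (φ.subtypeRestr hs).open_target.measurableSet)
          hbound
    _ ≤ ∫⁻ x in K ∩ φ.target, C ^ (q - 1) * (volumeDensity g φ x *
          ENNReal.ofReal (|f (φ.symm x)| ^ (m - n)) ^ q) :=
        lintegral_mono_set (inter_subset_inter_right _ (φ.subtypeRestr_target_subset hs))
    _ = C ^ (q - 1) * ∫⁻ p in φ.source ∩ φ ⁻¹' K,
          ENNReal.ofReal (|f p| ^ (m - n)) ^ q ∂riemVolume g := by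
        rw [lintegral_const_mul' _ _ hCtop, setLIntegral_riemVolume g hφ hK.measurableSet]
    _ ≤ C ^ (q - 1) * ∫⁻ p, ENNReal.ofReal (|f p| ^ (m - n)) ^ q ∂riemVolume g := by
        gcongr
        exact Measure.restrict_le_self

theorem isAdmissibleBall [T2Space M] {N : Set M} {hN : IsCompact N}
    {hs : Nonempty (complOpens hN)} {g' : SmoothMetric m (complOpens hN)}
    (hgram : HasBlockScaledGram n hs g g' f φ) (hmn : n + 2 ≤ m) (hφ : IsSliceChart n N φ)
    {q : ℝ} (hq : 1 < q) (hmq : m < 2 * q)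
    (hf : ∫⁻ p, ENNReal.ofReal (|f p| ^ (m - n)) ^ q ∂riemVolume g ≠ ⊤) {C : ℝ≥0}
    (hC : ∀ p ∈ Nᶜ, ∀ i : Fin m, blockScale m n (f p) i ^ 2 ≤ C * |f p| ^ (m - n))
    {y : Rm m} {r : ℝ} (hr : 0 < r) (hB : Metric.closedBall y (2 * r) ⊆ φ.target) :
    IsAdmissibleBall g' (φ.subtypeRestr hs) y r where
  mem_maximalAtlas := subtypeRestr_mem_maximalAtlas_of_mem_maximalAtlas hs hφ.1
  radius_pos := hr
  exists_exponent := ⟨q, hq, hmq,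
    hgram.lintegral_volumeDensity_rpow_ne_top hφ.1 hq.le hf (isCompact_closedBall _ _) hB⟩
  ae_segment := by
    filter_upwards [hφ.ae_ae_segment_notMem hmn] with x hx
    filter_upwards [hx] with z hz hxB hzB w hw
    have hwφ := hB ((convex_closedBall y (2 * r)).segment_subset hxB hzB hw)
    exact (mem_subtypeRestr_target_iff hs).2 ⟨hwφ, hz w hw hwφ⟩
  exists_trace_le := hgram.exists_trace_le hφ.1 hC (isCompact_closedBall _ _) hB

end HasBlockScaledGram

end BlockScaledMetric

section IntegrabilityExponent

variable {α : Type*} [MeasurableSpace α] {μ : Measure α} {f : α → ℝ} {p : ℝ}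

theorem lintegral_abs_pow_rpow_ne_top_of_memLp (hp : 0 < p) (hf : MemLp f (ENNReal.ofReal p) μ)
    {k : ℕ} {q : ℝ} (hkq : k * q = p) : ∫⁻ x, ENNReal.ofReal (|f x| ^ k) ^ q ∂μ ≠ ⊤ := by
  have hnorm := lintegral_rpow_enorm_lt_top_of_eLpNorm_lt_top (ENNReal.ofReal_pos.2 hp).ne'
    ENNReal.ofReal_ne_top hf.2
  refine ne_of_eq_of_ne (lintegral_congr fun x => ?_) hnorm.ne
  rw [ENNReal.toReal_ofReal hp.le, ENNReal.ofReal_pow (abs_nonneg _), ← Real.norm_eq_abs,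
    ofReal_norm, ← ENNReal.rpow_natCast, ← ENNReal.rpow_mul, hkq]

theorem exists_exponent_of_memLp {m n : ℕ} (hmn : n + 2 ≤ m) (hp : (m : ℝ) * (m - n) / 2 < p)
    (hf : MemLp f (ENNReal.ofReal p) μ) :
    ∃ q : ℝ, 1 < q ∧ m < 2 * q ∧ ∫⁻ x, ENNReal.ofReal (|f x| ^ (m - n)) ^ q ∂μ ≠ ⊤ := by
  have hmn' : (n : ℝ) + 2 ≤ m := by exact_mod_cast hmn
  have hk : (0 : ℝ) < m - n := by linarith
  have hmq : m < 2 * (p / (m - n)) := by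
    rw [← mul_div_assoc, lt_div_iff₀ hk]
    linarith
  refine ⟨p / (m - n), by linarith [n.cast_nonneg (α := ℝ)], hmq,
    lintegral_abs_pow_rpow_ne_top_of_memLp (lt_of_le_of_lt (by positivity) hp) hf ?_⟩
  rw [Nat.cast_sub (by omega), mul_div_cancel₀ _ hk.ne']

end IntegrabilityExponent

end

theorem theorem1p1_general {m n : ℕ} (hmn : n + 2 ≤ m)
    {M : Type*} [TopologicalSpace M] [T2Space M] [CompactSpace M]
    [ChartedSpace (Rm m) M] [IsManifold (𝓡 m) ∞ M] [MeasurableSpace M] [BorelSpace M]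
    (g : SmoothMetric m M) (N : Set M) (hN : IsCompact N) (g' : SmoothMetric m (complOpens hN))
    (f : M → ℝ)
    (hdiag : ∀ p ∈ N, ∃ φ : OpenPartialHomeomorph M (Rm m), p ∈ φ.source ∧
      IsSliceChart n N φ ∧
      ∃ (g₁ : M → Matrix (Fin (m - n)) (Fin (m - n)) ℝ) (g₂ : M → Matrix (Fin n) (Fin n) ℝ),
        (∀ q ∈ φ.source, ∀ v w : TangentSpace (𝓡 m) q,
          g.inner q v w =
            blockForm (Nat.le_of_add_right_le hmn) φ (g₁ q) (g₂ q) q v w) ∧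
        (∀ q : complOpens hN, (q : M) ∈ φ.source → ∀ v w : TangentSpace (𝓡 m) q,
          g'.inner q v w =
            blockForm (Nat.le_of_add_right_le hmn) (fun x : complOpens hN => φ x)
              (f q ^ 2 • g₁ q) (g₂ q) q v w))
    {p : ℝ} (hp : (m : ℝ) * (m - n) / 2 < p) (hfp : MemLp f (ENNReal.ofReal p) (riemVolume g))
    (hf : 3 ≤ m → ∃ c : ℝ, 0 < c ∧ ∀ q ∈ Nᶜ, c ≤ |f q|) :
    SobolevCompactlyIncluded g' := by
  rcases isEmpty_or_nonempty (complOpens hN) with hempty | hs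
  · exact sobolevCompactlyIncluded_of_admissibleBalls (by omega) (ψ := Empty.elim) (y := Empty.elim)
      (r := Empty.elim) (fun j => j.elim) (Subsingleton.elim _ _)
  obtain ⟨q, hq, hmq, hfq⟩ := exists_exponent_of_memLp hmn hp hfp
  obtain ⟨C, hC⟩ := exists_blockScale_sq_le hmn (s := f '' Nᶜ) (by simpa using hf)
  refine sobolevCompactlyIncluded_of_forall_exists_isAdmissibleBall (hs := hs) (by omega)
    fun x => ?_
  by_cases hx : x ∈ N
  · obtain ⟨φ, hxφ, hφ, g₁, g₂, hg, hg'⟩ := hdiag x hx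
    obtain ⟨r, hr, hB⟩ := exists_pos_closedBall_two_mul_subset
      (φ.open_target.mem_nhds (φ.map_source hxφ))
    exact ⟨φ, hxφ, r, (hasBlockScaledGram_of_inner_eq_blockForm _ hφ.1 hg hg').isAdmissibleBall
      hmn hφ hq hmq hfq (fun z hz => hC _ (mem_image_of_mem f hz)) hr hB⟩
  · exact ⟨chartAt (Rm m) x, mem_chart_source _ x, exists_isAdmissibleBall_chartAt (by omega) g' hx⟩

theorem theorem1p1 {m n : ℕ} (hmn : n + 2 ≤ m)
    {M : Type*} [TopologicalSpace M] [T2Space M] [CompactSpace M]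
    [ChartedSpace (Rm m) M] [IsManifold (𝓡 m) ∞ M] [MeasurableSpace M] [BorelSpace M]
    (g : SmoothMetric m M)
    (N : Set M) (hN : IsCompact N) (hNsub : IsSubmanifold (m := m) n N)
    (g' : SmoothMetric m (complOpens hN))
    (f : M → ℝ) (hf : ContMDiffOn (𝓡 m) 𝓘(ℝ, ℝ) ∞ f Nᶜ)
    -- near every point of `N` there are coordinates `(x, y)`, with `N = {x = 0}`, in which
    -- `g = diag(g₁, g₂)` and, off `N`, `g' = diag(f² g₁, g₂)`
    (hdiag : ∀ p ∈ N, ∃ φ : OpenPartialHomeomorph M (Rm m), p ∈ φ.source ∧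
      IsSliceChart n N φ ∧
      ∃ (g₁ : M → Matrix (Fin (m - n)) (Fin (m - n)) ℝ) (g₂ : M → Matrix (Fin n) (Fin n) ℝ),
        (∀ q ∈ φ.source, ∀ v w : TangentSpace (𝓡 m) q,
          g.inner q v w =
            blockForm (Nat.le_of_add_right_le hmn) φ (g₁ q) (g₂ q) q v w) ∧
        (∀ q : complOpens hN, (q : M) ∈ φ.source → ∀ v w : TangentSpace (𝓡 m) q,
          g'.inner q v w =
            blockForm (Nat.le_of_add_right_le hmn) (fun x : complOpens hN => φ x)
              (f q ^ 2 • g₁ q) (g₂ q) q v w))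
    (hf₂ : m = 2 → ∃ ε : ℝ, 0 < ε ∧ MemLp f (ENNReal.ofReal (2 + ε)) (riemVolume g))
    (hf₃ : 3 ≤ m → (∃ c : ℝ, 0 < c ∧ ∀ q ∈ Nᶜ, c ≤ f q) ∧
      ∃ ε : ℝ, 0 < ε ∧
        MemLp f (ENNReal.ofReal ((m : ℝ) * ((m : ℝ) - n) / 2 + ε)) (riemVolume g)) :
    SobolevCompactlyIncluded g' := by
  rcases (show 2 ≤ m by omega).eq_or_lt with rfl | hm
  · obtain rfl : n = 0 := by omega
    obtain ⟨ε, hε, hfε⟩ := hf₂ rfl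
    exact theorem1p1_general hmn g N hN g' f hdiag (p := 2 + ε) (by norm_num; exact hε) hfε
      (by omega)
  · obtain ⟨⟨c, hc, hcf⟩, ε, hε, hfε⟩ := hf₃ hm
    exact theorem1p1_general hmn g N hN g' f hdiag (lt_add_of_pos_right _ hε) hfε
      fun _ => ⟨c, hc, fun q hq => (hcf q hq).trans (le_abs_self _)⟩
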